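/- Let $\alpha\in(0,1)$, let $c = 1/\sum_{k\ge 0} e^{-k^\alpha}$, and let $X_1,X_2,\ldots$ be i.i.d. $\mathbb N_0$-valued random variables with $\mathbb P(X_i=k)=c\,e^{-k^\alpha}$ for $k\in\mathbb N_0$, with expected value $\mu$ and variance $\sigma^2$. Put $S_n=X_1+\cdots+X_n$, $M_n=\max(X_1,\ldots,X_n)$ and $\gamma=1/(2-\alpha)$. For $s\in\mathbb R$ and a decreasing sequence $x_1\ge x_2\ge\cdots$ in $\mathbb R_+=[0,\infty)$ let \[ F_s(x_1,x_2,\ldots)=\sum_{j\ge1}x_j^\alpha+\frac1{2\sigma^2}\Bigl(s-\sum_{j\ge1}x_j\Bigr)^2\in[0,\infty], \] and for $y\in\mathbb R_+$ let $f_s(y)$ be the infimum of $F_s$ over all decreasing sequences in $\mathbb R_+$ with $x_1=y$. Then $f_s(y)\in[0,\infty)$, and for all $s\in\mathbb R$ and $y\ge0$, \[ f_s(y)=y^\alpha+\inf_{z\in[0,y]}f_{s-y}(z). \] Let $(s_n)_{n\ge1}$ be a real sequence with $s_n\to s\in\mathbb R$ and $\mu n+s_nn^\gamma\in\mathbb N_0$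 for all $n\ge 1$, and let $Q_n$ be the distribution of $M_n/n^\gamma$ under $\mathbb P(\,\cdot\mid S_n=\mu n+s_nn^\gamma)$. Then $(Q_n)$ satisfies the large deviation principle on $\mathbb R_+$ with speed $n^{\gamma\alpha}$ and good rate function $I_s=f_s-\inf_{\mathbb R_+}f_s$; that is, $I_s\ge0$ is lower semicontinuous with compact sublevel sets, for every closed $A\subset\mathbb R_+$ \[ \limsup_{n\to\infty}\frac1{n^{\gamma\alpha}}\log Q_n(A)\le-\inf_{A}I_s, \] and for every open (relative to $\mathbb R_+$) set $O\subset\mathbb R_+$ \[ \liminf_{n\to\infty}\frac1{n^{\gamma\alpha}}\log Q_n(O)\ge-\inf_{O}I_s, \] with $\log 0=-\infty$ and $\inf_\varnothing I_s=+\infty$. -/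

import Mathlib

open MeasureTheory ProbabilityTheory Filter Topology
open scoped NNReal ENNReal

noncomputable section

namespace StretchedExp

/-- The normalizing constant `c = 1 / ∑_{k ≥ 0} exp (-k^α)`. -/
def normConst (α : ℝ) : ℝ := 1 / ∑' k : ℕ, Real.exp (-(k : ℝ) ^ α)

/-- The family `X` consists of i.i.d. `ℕ`-valued random variables with the stretched exponential
law `P (X i = k) = c exp (-k^α)`. -/
structure IsIIDStretchedExp {Ω : Type*} [MeasurableSpace Ω] (P : Measure Ω) (α : ℝ)
    (X : ℕ → Ω → ℕ) : Prop where
  measurable : ∀ i, Measurable (X i)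
  indep : iIndepFun X P
  law : ∀ i k, P {ω | X i ω = k} = ENNReal.ofReal (normConst α * Real.exp (-(k : ℝ) ^ α))

/-- The partial sum of the first `n` variables. -/
def partialSum {Ω : Type*} (X : ℕ → Ω → ℕ) (n : ℕ) (ω : Ω) : ℕ := ∑ i ∈ Finset.range n, X i ω

/-- The maximum of the first `n` variables (it is `0` if `n = 0`). -/
def partialMax {Ω : Type*} (X : ℕ → Ω → ℕ) (n : ℕ) (ω : Ω) : ℕ :=
  (Finset.range n).sup fun i => X i ω

/-- The law of `M_n / n^γ` on `[0, ∞)` under the conditional law `P (· | S_n = a)`. -/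
def condMaxLaw {Ω : Type*} [MeasurableSpace Ω] (P : Measure Ω) (X : ℕ → Ω → ℕ) (γ : ℝ) (n : ℕ)
    (a : ℝ) : Measure ℝ≥0 :=
  (ProbabilityTheory.cond P {ω | (partialSum X n ω : ℝ) = a}).map
    fun ω => (partialMax X n ω : ℝ≥0) / (n : ℝ≥0) ^ γ

/-- `F_s(x) = ∑ x_j^α + (s - ∑ x_j)^2 / (2 σ²)`, with values in `[0, ∞]`. The sums are taken in
`[0, ∞]`; if `∑ x_j = ∞` then the square is `∞`. -/
def F (α σ2 s : ℝ) (x : ℕ → ℝ≥0) : EReal :=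
  ((∑' j, ((x j ^ α : ℝ≥0) : ℝ≥0∞) : ℝ≥0∞) : EReal) +
    ((1 / (2 * σ2) : ℝ) : EReal) * ((s : EReal) - ((∑' j, (x j : ℝ≥0∞) : ℝ≥0∞) : EReal)) ^ 2

/-- `f_s(y)`, the infimum of `F_s` over decreasing sequences in `[0, ∞)` whose first term
is `y`. -/
def f (α σ2 s : ℝ) (y : ℝ≥0) : EReal :=
  ⨅ x ∈ {x : ℕ → ℝ≥0 | Antitone x ∧ x 0 = y}, F α σ2 s x

/-- A good rate function: nonnegative, lower semicontinuous, with compact sublevel sets. -/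
structure IsGoodRateFunction {E : Type*} [TopologicalSpace E] (I : E → EReal) : Prop where
  nonneg : ∀ x, 0 ≤ I x
  lowerSemicontinuous : LowerSemicontinuous I
  isCompact_sublevel : ∀ c : ℝ, IsCompact {x | I x ≤ (c : EReal)}

/-- The large deviation principle with speed `a n` and rate function `I`
(here `log 0 = -∞` and the infimum over the empty set is `+∞`). -/
structure SatisfiesLDP {E : Type*} [TopologicalSpace E] [MeasurableSpace E]
    (Q : ℕ → Measure E) (a : ℕ → ℝ) (I : E → EReal) : Prop where
  upper : ∀ A : Set E, IsClosed A →
    limsup (fun n => ENNReal.log (Q n A) / (a n : EReal)) atTop ≤ -⨅ y ∈ A, I y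
  lower : ∀ O : Set E, IsOpen O →
    -⨅ y ∈ O, I y ≤ liminf (fun n => ENNReal.log (Q n O) / (a n : EReal)) atTop

end StretchedExp

end

/-! There are two ways to move the sum by an amount of order `n^γ`. One variable equal to about `x
n^γ` costs `exp (-n^(γα) x^α)`; a collective Gaussian shift by `t n^γ` costs `exp (-n^(2γ-1) t² /
(2σ²))`. The choice of `γ` makes `2γ - 1 = γα`, so both act at the same speed, and the cheapest
combination with largest jump `y` costs `f_s(y)`. The core of the proof is that the joint
probability of `S_n = μn + s_n n^γ` and `M_n / n^γ ∈ A` is `exp (-n^(γα) inf_A f_s)` to leading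
order, as an upper bound for closed `A` and as a lower bound for open `A`. The conditional law is a
ratio of two such probabilities, the denominator having `A = ℝ≥0`.

Upper bound (`eventually_joint_le`). Exponential Chebyshev is applied to a product of weights
`tilt`: linear tilting with slope `a n^(γ-1)` for values up to `ε n^γ`, and nearly the inverse tail
`exp ((1-η) k^α)` above. On the event this product depends only on the entries above the level
(`prod_tilt_eq_exp`), and these form a competitor in the definition of `f`
(`le_finCost_of_max_mem`). No count of the large jumps or of their positions is needed. The
expectation of the product is `exp (n^(γα) a² σ² / 2)` to leading order, by a second order expansion
(`tendsto_tiltMean`). Optimizing over finitely many slopes recovers the quadratic cost.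

Lower bound (`eventually_le_joint`). A nearly optimal finite family of jumps is prescribed on the
last variables. The remaining bulk only has to hit a window of width of order `n^γ`
(`eventually_le_bulkEvent`, by tilting), and one further variable corrects the sum to its exact
value. This replaces a local limit theorem; the correction is at most `4κ n^γ`, so its cost vanishes
with `κ`.

The rate function is treated by splitting off the largest entry (`f_eq_rpow_add_iInf`) and by an
explicit modulus of semicontinuity (`f_le_add_of_lt`). -/

noncomputable section

namespace StretchedExp

/-! ### The variational problem: recursion and finite competitors -/

/-- The value of `F` at a sequence that consists of the entries `x j`, `j ∈ B`, and zeros. -/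
def finCost {ι : Type*} (α σ2 s : ℝ) (B : Finset ι) (x : ι → ℝ≥0) : ℝ :=
  ∑ j ∈ B, (x j : ℝ) ^ α + 1 / (2 * σ2) * (s - ∑ j ∈ B, (x j : ℝ)) ^ 2

lemma F_eq_coe_of_summable {α σ2 s : ℝ} {x : ℕ → ℝ≥0} (h₁ : Summable fun j => x j ^ α)
    (h₂ : Summable x) :
    F α σ2 s x = ((∑' j, (x j : ℝ) ^ α + 1 / (2 * σ2) * (s - ∑' j, (x j : ℝ)) ^ 2 : ℝ) : EReal) := by
  unfold F
  rw [← ENNReal.coe_tsum h₁, ← ENNReal.coe_tsum h₂]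
  have e₁ : (∑' j, (x j : ℝ) ^ α) = ((∑' j, x j ^ α : ℝ≥0) : ℝ) := by
    push_cast; rfl
  have e₂ : (∑' j, (x j : ℝ)) = ((∑' j, x j : ℝ≥0) : ℝ) := by push_cast; rfl
  rw [e₁, e₂]
  generalize (∑' j, x j ^ α : ℝ≥0) = A
  generalize (∑' j, x j : ℝ≥0) = C
  push_cast
  rfl

lemma F_nonneg {α σ2 : ℝ} (hσ : 0 < σ2) (s : ℝ) (x : ℕ → ℝ≥0) : 0 ≤ F α σ2 s x := by
  unfold F
  refine add_nonneg (EReal.coe_ennreal_nonneg _) (mul_nonneg ?_ ?_)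
  · exact_mod_cast (by positivity : (0 : ℝ) ≤ 1 / (2 * σ2))
  · generalize (s : EReal) - _ = u
    induction u with
    | bot => simp [pow_two]
    | top => simp [pow_two]
    | coe r => exact_mod_cast sq_nonneg r

lemma summable_of_F_lt_top {α σ2 s : ℝ} (hσ : 0 < σ2) {x : ℕ → ℝ≥0} (h : F α σ2 s x < ⊤) :
    (Summable fun j => x j ^ α) ∧ Summable x := by
  rw [← ENNReal.tsum_coe_ne_top_iff_summable, ← ENNReal.tsum_coe_ne_top_iff_summable]
  unfold F at h
  have hc : (0 : EReal) < ((1 / (2 * σ2) : ℝ) : EReal) := by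
    exact_mod_cast (by positivity : (0 : ℝ) < 1 / (2 * σ2))
  have hsq : ∀ u : EReal, 0 ≤ u ^ 2 := by
    intro u
    induction u with
    | bot => simp [pow_two]
    | top => simp [pow_two]
    | coe r => exact_mod_cast sq_nonneg r
  constructor
  · intro ht
    rw [ht] at h
    refine h.ne ?_
    rw [EReal.coe_ennreal_top, EReal.top_add_of_ne_bot]
    exact ne_of_gt (lt_of_lt_of_le EReal.bot_lt_zero (mul_nonneg hc.le (hsq _)))
  · intro ht
    rw [ht] at h
    refine h.ne ?_
    have : ((s : EReal) - ((⊤ : ℝ≥0∞) : EReal)) ^ 2 = ⊤ := by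
      rw [EReal.coe_ennreal_top, EReal.sub_top, pow_two]; simp
    rw [this, EReal.mul_top_of_pos hc, EReal.add_top_of_ne_bot]
    exact ne_of_gt (lt_of_lt_of_le EReal.bot_lt_zero (EReal.coe_ennreal_nonneg _))

/-- Only the finite number `x 0` is moved into the parameter, so the identity in `EReal` survives an
infinite tail sum. -/
lemma F_cons (α σ2 s : ℝ) (x : ℕ → ℝ≥0) :
    F α σ2 s x = (((x 0 : ℝ) ^ α : ℝ) : EReal) + F α σ2 (s - x 0) fun j => x (j + 1) := by
  unfold F
  rw [tsum_eq_zero_add' (f := fun j => ((x j ^ α : ℝ≥0) : ℝ≥0∞)) ENNReal.summable,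
    tsum_eq_zero_add' (f := fun j => ((x j : ℝ≥0) : ℝ≥0∞)) ENNReal.summable]
  generalize (∑' j, ((x (j + 1) : ℝ≥0) : ℝ≥0∞)) = T
  rw [EReal.coe_ennreal_add, EReal.coe_ennreal_add, add_assoc]
  congr 1
  congr 3
  rw [sub_eq_add_neg, sub_eq_add_neg, EReal.neg_add, EReal.coe_sub, sub_eq_add_neg, sub_eq_add_neg,
    add_assoc]
  · rfl
  · left; simp
  · left; simp

lemma f_nonneg {α σ2 : ℝ} (hσ : 0 < σ2) (s : ℝ) (y : ℝ≥0) : 0 ≤ f α σ2 s y :=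
  le_iInf₂ fun x _ => F_nonneg hσ s x

lemma f_zero_le {α : ℝ} (hα : 0 < α) (σ2 s : ℝ) :
    f α σ2 s 0 ≤ ((1 / (2 * σ2) * s ^ 2 : ℝ) : EReal) := by
  refine (iInf₂_le (fun _ => 0) ⟨antitone_const, rfl⟩).trans ?_
  rw [F_eq_coe_of_summable (by simp [NNReal.zero_rpow hα.ne'])
    summable_zero]
  simp [Real.zero_rpow hα.ne']

/-- The recursion for `f`: split off the largest entry. -/
lemma f_eq_rpow_add_iInf {α σ2 : ℝ} (s : ℝ) (y : ℝ≥0) :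
    f α σ2 s y = (((y : ℝ) ^ α : ℝ) : EReal) + ⨅ z ∈ Set.Icc 0 y, f α σ2 (s - y) z := by
  apply le_antisymm
  -- The real number `y^α` is moved to the other side, so that the infimum can be tested on each
  -- sequence separately.
  · rw [add_comm, ← EReal.sub_le_iff_le_add (by simp) (by simp)]
    refine le_iInf₂ fun z hz => le_iInf₂ fun x hx => ?_
    rw [EReal.sub_le_iff_le_add (by simp) (by simp), add_comm]
    let x' : ℕ → ℝ≥0 := fun j => Nat.casesOn j y x
    have h := F_cons α σ2 s x'
    change F α σ2 s x' = (((y : ℝ) ^ α : ℝ) : EReal) + F α σ2 (s - y) x at h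
    rw [← h]
    refine iInf₂_le x' ⟨antitone_nat_of_succ_le fun j => ?_, rfl⟩
    cases j with
    | zero => exact hx.2.le.trans hz.2
    | succ j => exact hx.1 (Nat.le_succ j)
  · refine le_iInf₂ fun x hx => ?_
    rw [F_cons, hx.2]
    refine add_le_add le_rfl ?_
    refine (iInf₂_le (x 1) ⟨zero_le, hx.2 ▸ hx.1 zero_le_one⟩).trans ?_
    exact iInf₂_le _ ⟨fun i j hij => hx.1 (Nat.succ_le_succ hij), rfl⟩

/-- Coercivity: this is what bounds the sublevel sets. -/
lemma rpow_le_f {α σ2 : ℝ} (hσ : 0 < σ2) (s : ℝ) (y : ℝ≥0) :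
    (((y : ℝ) ^ α : ℝ) : EReal) ≤ f α σ2 s y := by
  rw [f_eq_rpow_add_iInf]
  exact le_add_of_nonneg_right (le_iInf₂ fun z _ => f_nonneg hσ _ z)

/-- The infimum defining `f` also runs over unordered finite families. -/
lemma f_sup_le_finCost {ι : Type*} {α : ℝ} (hα : 0 < α) (σ2 s : ℝ) (B : Finset ι) (x : ι → ℝ≥0) :
    f α σ2 s (B.sup x) ≤ (finCost α σ2 s B x : EReal) := by
  classical
  -- Entries are inserted in increasing order, so the new one is the maximum and the recursion for
  -- `f` splits it off.
  induction B using Finset.induction_on_max_value x generalizing s with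
  | empty => simpa [finCost] using f_zero_le hα σ2 s
  | insert a B ha hB ih =>
    have hsup : B.sup x ≤ x a := Finset.sup_le hB
    rw [Finset.sup_insert, sup_of_le_left hsup, f_eq_rpow_add_iInf]
    have h : finCost α σ2 s (insert a B) x = (x a : ℝ) ^ α + finCost α σ2 (s - x a) B x := by
      unfold finCost
      rw [Finset.sum_insert ha, Finset.sum_insert ha]
      ring
    rw [h, EReal.coe_add]
    exact add_le_add le_rfl ((iInf₂_le _ ⟨zero_le, hsup⟩).trans (ih _))

lemma f_lt_top {α : ℝ} (hα : 0 < α) (σ2 s : ℝ) (y : ℝ≥0) : f α σ2 s y < ⊤ := by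
  have h := f_sup_le_finCost hα σ2 s {0} (fun _ : ℕ => y)
  rw [Finset.sup_singleton] at h
  exact h.trans_lt (EReal.coe_lt_top _)

/-- Finitely supported sequences suffice in the infimum defining `f`. -/
lemma exists_finCost_lt {α σ2 s c : ℝ} (hσ : 0 < σ2) {y : ℝ≥0} (h : f α σ2 s y < c) :
    ∃ x : ℕ → ℝ≥0, ∃ k : ℕ, (∀ j, x j ≤ y) ∧ x 0 = y ∧
      finCost α σ2 s (Finset.range (k + 1)) x < c := by
  simp only [f, iInf_lt_iff] at h
  obtain ⟨x, ⟨hx, hx0⟩, hF⟩ := h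
  obtain ⟨h₁, h₂⟩ := summable_of_F_lt_top hσ (hF.trans (EReal.coe_lt_top _))
  rw [F_eq_coe_of_summable h₁ h₂, EReal.coe_lt_coe_iff] at hF
  have t₁ : Tendsto (fun k => ∑ j ∈ Finset.range k, (x j : ℝ) ^ α) atTop
      (𝓝 (∑' j, (x j : ℝ) ^ α)) := by
    refine HasSum.tendsto_sum_nat (Summable.hasSum ?_)
    exact_mod_cast h₁
  have t₂ : Tendsto (fun k => ∑ j ∈ Finset.range k, (x j : ℝ)) atTop (𝓝 (∑' j, (x j : ℝ))) := by
    refine HasSum.tendsto_sum_nat (Summable.hasSum ?_)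
    exact_mod_cast h₂
  have t : Tendsto (fun k => finCost α σ2 s (Finset.range (k + 1)) x) atTop (𝓝 _) :=
    (t₁.add (((tendsto_const_nhds.sub t₂).pow 2).const_mul (1 / (2 * σ2)))).comp
      (tendsto_add_atTop_nat 1)
  obtain ⟨k, hk⟩ := (t.eventually_lt_const hF).exists
  exact ⟨x, k, fun j => hx0 ▸ hx (Nat.zero_le j), hx0, hk⟩

/-! ### Lower semicontinuity and compact sublevel sets -/

/-- A modulus of lower semicontinuity for `f`. -/
lemma f_le_add_of_lt {α σ2 s c : ℝ} (hα₀ : 0 < α) (hα₁ : α < 1) (hσ : 0 < σ2) {y y' : ℝ≥0}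
    (h : f α σ2 s y' < c) {Δ : ℝ}
    (hΔ : Δ = |(y : ℝ) - y'| + |(y : ℝ) - y'| ^ (1 - α) * c) :
    f α σ2 s y ≤ ((c + (|(y : ℝ) ^ α - (y' : ℝ) ^ α| +
      1 / (2 * σ2) * (2 * Δ * √(2 * σ2 * c) + Δ ^ 2)) : ℝ) : EReal) := by
  obtain ⟨x, k, hx, hx0, hc⟩ := exists_finCost_lt hσ h
  -- A near-optimal family for `y'` becomes one with maximum `y`: the first entry is replaced by
  -- `y`, the others are capped at `y`. Capping does not increase their power sum, so only the
  -- change of the total needs control.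
  let x' : ℕ → ℝ≥0 := fun j => if j = 0 then y else min (x j) y
  have hsup : (Finset.range (k + 1)).sup x' = y := by
    apply le_antisymm
    · refine Finset.sup_le fun j _ => ?_
      by_cases hj : j = 0 <;> simp [x', hj]
    · exact (by simp [x'] : y ≤ x' 0).trans (Finset.le_sup (by simp))
  have hle := f_sup_le_finCost hα₀ σ2 s (Finset.range (k + 1)) x'
  rw [hsup] at hle
  refine hle.trans (EReal.coe_le_coe_iff.2 ?_)
  unfold finCost at hc ⊢
  set S₁ := ∑ j ∈ Finset.range (k + 1), (x j : ℝ) ^ α with hS₁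
  set S := ∑ j ∈ Finset.range (k + 1), (x j : ℝ) with hS
  have hS₁0 : 0 ≤ S₁ := Finset.sum_nonneg fun j _ => by positivity
  have hq0 : 0 ≤ 1 / (2 * σ2) * (s - S) ^ 2 := by positivity
  have hS₁c : S₁ ≤ c := by linarith
  have h1 : ∑ j ∈ Finset.range (k + 1), (x' j : ℝ) ^ α ≤ S₁ + |(y : ℝ) ^ α - (y' : ℝ) ^ α| := by
    rw [hS₁, Finset.sum_range_succ', Finset.sum_range_succ', hx0]
    have : ∑ j ∈ Finset.range k, (x' (j + 1) : ℝ) ^ α ≤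
        ∑ j ∈ Finset.range k, (x (j + 1) : ℝ) ^ α := by
      refine Finset.sum_le_sum fun j _ => ?_
      refine Real.rpow_le_rpow (by positivity) ?_ hα₀.le
      simp [x']
    have h0 : (x' 0 : ℝ) = y := by simp [x']
    rw [h0]
    linarith [le_abs_self ((y : ℝ) ^ α - (y' : ℝ) ^ α)]
  have h2 : |∑ j ∈ Finset.range (k + 1), (x' j : ℝ) - S| ≤ Δ := by
    rw [hS, ← Finset.sum_sub_distrib, Finset.sum_range_succ', hx0]
    have h0 : (x' 0 : ℝ) = y := by simp [x']
    rw [h0, hΔ, add_comm]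
    refine (abs_add_le _ _).trans (add_le_add le_rfl ?_)
    refine (Finset.abs_sum_le_sum_abs _ _).trans ?_
    -- Writing the loss as `u = u^(1-α) u^α` bounds the total change by the power sum, which is at
    -- most `c`. The bound is therefore independent of the number of entries.
    have hterm : ∀ j, |(x' (j + 1) : ℝ) - x (j + 1)| ≤
        |(y : ℝ) - y'| ^ (1 - α) * (x (j + 1) : ℝ) ^ α := by
      intro j
      have hxy : (x (j + 1) : ℝ) ≤ y' := by exact_mod_cast hx (j + 1)
      have hx0' : (0 : ℝ) ≤ x (j + 1) := NNReal.coe_nonneg _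
      have hy0 : (0 : ℝ) ≤ y := NNReal.coe_nonneg _
      have e : (x' (j + 1) : ℝ) = min (x (j + 1) : ℝ) y := by simp [x']
      rw [e]
      rcases le_total (x (j + 1) : ℝ) y with hle | hle
      · rw [min_eq_left hle, sub_self, abs_zero]; positivity
      · rw [min_eq_right hle, abs_sub_comm, abs_of_nonneg (by linarith)]
        have hu : 0 ≤ (x (j + 1) : ℝ) - y := by linarith
        calc (x (j + 1) : ℝ) - y
            = ((x (j + 1) : ℝ) - y) ^ (1 - α) * ((x (j + 1) : ℝ) - y) ^ α := by
              rw [← Real.rpow_add' hu (by simp)]; simp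
          _ ≤ _ := by
              refine mul_le_mul (Real.rpow_le_rpow hu ?_ (by linarith))
                (Real.rpow_le_rpow hu (by linarith) hα₀.le) (by positivity) (by positivity)
              rw [abs_sub_comm]
              exact (by linarith : _ ≤ (y' : ℝ) - y).trans (le_abs_self _)
    refine (Finset.sum_le_sum fun j _ => hterm j).trans ?_
    rw [← Finset.mul_sum]
    refine mul_le_mul_of_nonneg_left ?_ (by positivity)
    refine le_trans ?_ hS₁c
    rw [hS₁, Finset.sum_range_succ']
    exact le_add_of_nonneg_right (by positivity)
  have hΔ0 : 0 ≤ Δ := (abs_nonneg _).trans h2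
  -- The quadratic part of the cost alone is at most `c`.
  have h3 : |s - S| ≤ √(2 * σ2 * c) := by
    rw [← Real.sqrt_sq_eq_abs]
    refine Real.sqrt_le_sqrt ?_
    have h' : 1 / (2 * σ2) * (s - S) ^ 2 ≤ c := by linarith
    rw [one_div_mul_eq_div, div_le_iff₀ (by positivity)] at h'
    linarith
  have h4 : (s - ∑ j ∈ Finset.range (k + 1), (x' j : ℝ)) ^ 2 ≤
      (s - S) ^ 2 + (2 * Δ * √(2 * σ2 * c) + Δ ^ 2) := by
    set D := ∑ j ∈ Finset.range (k + 1), (x' j : ℝ) - S with hD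
    have e : s - ∑ j ∈ Finset.range (k + 1), (x' j : ℝ) = (s - S) - D := by rw [hD]; ring
    rw [e]
    have hD2 : D ^ 2 ≤ Δ ^ 2 := by rw [← sq_abs]; gcongr
    have hp : -((s - S) * D) ≤ Δ * √(2 * σ2 * c) := by
      refine (neg_le_abs _).trans ?_
      rw [abs_mul, mul_comm]
      gcongr
    nlinarith
  have h5 := mul_le_mul_of_nonneg_left h4 (by positivity : 0 ≤ 1 / (2 * σ2))
  rw [mul_add] at h5
  linarith

lemma lowerSemicontinuous_f {α σ2 : ℝ} (hα₀ : 0 < α) (hα₁ : α < 1) (hσ : 0 < σ2) (s : ℝ) :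
    LowerSemicontinuous (f α σ2 s) := by
  intro y J hJ
  obtain ⟨c, hJc, hc⟩ := EReal.lt_iff_exists_real_btwn.1 hJ
  obtain ⟨c', hcc', hc'⟩ := EReal.lt_iff_exists_real_btwn.1 hc
  have hcc'' : c < c' := by exact_mod_cast hcc'
  let Δ : ℝ≥0 → ℝ := fun y' => |(y : ℝ) - y'| + |(y : ℝ) - y'| ^ (1 - α) * c
  let e : ℝ≥0 → ℝ := fun y' => c + (|(y : ℝ) ^ α - (y' : ℝ) ^ α| +
      1 / (2 * σ2) * (2 * Δ y' * √(2 * σ2 * c) + Δ y' ^ 2))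
  have hΔc : Continuous Δ := by
    have h1 : Continuous fun y' : ℝ≥0 => |(y : ℝ) - y'| := by fun_prop
    exact h1.add ((h1.rpow_const fun _ => Or.inr (by linarith)).mul continuous_const)
  have hec : Continuous e := by
    have h1 : Continuous fun y' : ℝ≥0 => (y' : ℝ) ^ α :=
      NNReal.continuous_coe.rpow_const fun _ => Or.inr hα₀.le
    fun_prop
  -- At `y' = y` the error terms vanish, so by continuity the bound stays below `c'` near `y`. A
  -- value `f y' ≤ J < c` would then force `f y < c'`, against the choice of `c'`.
  have hΔ0 : Δ y = 0 := by simp [Δ, Real.zero_rpow (by linarith : 1 - α ≠ 0)]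
  have he0 : e y = c := by simp [e, hΔ0]
  have hev : ∀ᶠ y' in 𝓝 y, e y' < c' :=
    (hec.tendsto y).eventually_lt_const (by rw [he0]; exact hcc'')
  filter_upwards [hev] with y' hy'
  by_contra hcon
  have h := f_le_add_of_lt hα₀ hα₁ hσ (y := y) ((not_lt.1 hcon).trans_lt hJc) rfl
  exact absurd (h.trans_lt (EReal.coe_lt_coe_iff.2 hy')) (not_lt.2 hc'.le)

/-- Since the infimum is a real number, subtracting it in `EReal` can be undone. -/
lemma exists_iInf_f_eq_coe {α σ2 : ℝ} (hα₀ : 0 < α) (hσ : 0 < σ2) (s : ℝ) :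
    ∃ I₀ : ℝ, ⨅ z, f α σ2 s z = (I₀ : EReal) := by
  have h0 : 0 ≤ ⨅ z, f α σ2 s z := le_iInf fun z => f_nonneg hσ s z
  have h1 : ⨅ z, f α σ2 s z < ⊤ := (iInf_le _ 0).trans_lt (f_lt_top hα₀ σ2 s 0)
  exact ⟨_, (EReal.coe_toReal h1.ne (ne_of_gt (EReal.bot_lt_zero.trans_le h0))).symm⟩

lemma isGoodRateFunction_f_sub {α σ2 : ℝ} (hα₀ : 0 < α) (hα₁ : α < 1) (hσ : 0 < σ2) (s : ℝ) :
    IsGoodRateFunction fun y : ℝ≥0 => f α σ2 s y - ⨅ z : ℝ≥0, f α σ2 s z := by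
  obtain ⟨I₀, hI₀⟩ := exists_iInf_f_eq_coe hα₀ hσ s
  rw [hI₀]
  have key : ∀ (y : ℝ≥0) (c : EReal), f α σ2 s y - I₀ ≤ c ↔ f α σ2 s y ≤ c + I₀ := fun y c =>
    EReal.sub_le_iff_le_add (by simp) (by simp)
  have hlsc : LowerSemicontinuous fun y : ℝ≥0 => f α σ2 s y - I₀ := by
    rw [lowerSemicontinuous_iff_isClosed_preimage]
    intro c
    have := lowerSemicontinuous_iff_isClosed_preimage.1 (lowerSemicontinuous_f hα₀ hα₁ hσ s)
      (c + I₀)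
    convert this using 1
    ext y
    exact key y c
  refine ⟨fun y => ?_, hlsc, fun c => ?_⟩
  · rw [EReal.le_sub_iff_add_le (by simp) (by simp), zero_add, ← hI₀]
    exact iInf_le _ y
  · refine IsCompact.of_isClosed_subset (isCompact_Icc (a := (0 : ℝ≥0))
      (b := Real.toNNReal ((c + I₀) ^ (1 / α))))
      (lowerSemicontinuous_iff_isClosed_preimage.1 hlsc c) fun y hy => ⟨zero_le, ?_⟩
    have h1 := (rpow_le_f hσ s y).trans ((key y c).1 hy)
    rw [← EReal.coe_add, EReal.coe_le_coe_iff] at h1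
    refine NNReal.le_toNNReal_of_coe_le ?_
    calc (y : ℝ) = ((y : ℝ) ^ α) ^ (1 / α) := by
          rw [one_div, Real.rpow_rpow_inv (NNReal.coe_nonneg _) hα₀.ne']
      _ ≤ _ := Real.rpow_le_rpow (by positivity) h1 (by positivity)

/-! ### Weights of the law and the truncated tilting -/

/-- The probability weight `c exp (-k^α)`. -/
def weight (α : ℝ) (k : ℕ) : ℝ := normConst α * Real.exp (-(k : ℝ) ^ α)

lemma summable_rpow_mul_exp_neg {α η : ℝ} (hα : 0 < α) (hη : 0 < η) {r : ℝ} (hr : 0 ≤ r) :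
    Summable fun k : ℕ => (1 + (k : ℝ)) ^ r * Real.exp (-η * (k : ℝ) ^ α) := by
  have h1 : (fun k : ℕ => Real.exp (-η * (k : ℝ) ^ α)) =O[atTop]
      -- The exponent is chosen so that this power of `k^α` is `k^(-(r+2))`; multiplied by `k^r` it
      -- leaves the summable `k^(-2)`.
      fun k : ℕ => ((k : ℝ) ^ α) ^ (-(r + 2) / α) :=
    ((isLittleO_exp_neg_mul_rpow_atTop hη (-(r + 2) / α)).comp_tendsto
      ((tendsto_rpow_atTop hα).comp tendsto_natCast_atTop_atTop)).isBigO
  have h2 : (fun k : ℕ => (1 + (k : ℝ)) ^ r) =O[atTop] fun k : ℕ => (k : ℝ) ^ r := by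
    refine Asymptotics.IsBigO.of_bound (2 ^ r) ?_
    filter_upwards [eventually_ge_atTop 1] with k hk
    have hk' : (1 : ℝ) ≤ k := by exact_mod_cast hk
    rw [Real.norm_of_nonneg (by positivity), Real.norm_of_nonneg (by positivity),
      ← Real.mul_rpow (by norm_num) (by positivity)]
    exact Real.rpow_le_rpow (by positivity) (by linarith) hr
  refine summable_of_isBigO_nat (Real.summable_nat_rpow.2 (by norm_num : (-2 : ℝ) < -1))
    ((h2.mul h1).trans (Asymptotics.IsBigO.of_bound 1 ?_))
  filter_upwards [eventually_ge_atTop 1] with k hk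
  have hk' : (0 : ℝ) < k := by exact_mod_cast hk
  rw [one_mul, ← Real.rpow_mul hk'.le, ← Real.rpow_add hk']
  refine le_of_eq ?_
  congr 2
  field_simp
  ring

lemma summable_exp_neg_rpow {α : ℝ} (hα : 0 < α) :
    Summable fun k : ℕ => Real.exp (-(k : ℝ) ^ α) := by
  simpa using summable_rpow_mul_exp_neg hα one_pos le_rfl (r := 0)

lemma normConst_pos {α : ℝ} (hα : 0 < α) : 0 < normConst α :=
  one_div_pos.2 ((summable_exp_neg_rpow hα).tsum_pos (fun _ => (Real.exp_pos _).le) 0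
    (Real.exp_pos _))

lemma weight_pos {α : ℝ} (hα : 0 < α) (k : ℕ) : 0 < weight α k :=
  mul_pos (normConst_pos hα) (Real.exp_pos _)

lemma summable_weight_mul {α η : ℝ} (hα : 0 < α) (hη : 0 < η) {C r : ℝ} (hr : 0 ≤ r)
    {g : ℕ → ℝ} (hg : ∀ k : ℕ, |g k| ≤ C * (1 + (k : ℝ)) ^ r * Real.exp ((1 - η) * (k : ℝ) ^ α)) :
    Summable fun k => weight α k * g k := by
  refine Summable.of_norm_bounded
    ((summable_rpow_mul_exp_neg hα hη hr).mul_left (normConst α * C)) fun k => ?_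
  rw [Real.norm_eq_abs, abs_mul, abs_of_pos (weight_pos hα k)]
  refine (mul_le_mul_of_nonneg_left (hg k) (weight_pos hα k).le).trans (le_of_eq ?_)
  have : -η * (k : ℝ) ^ α = -(k : ℝ) ^ α + (1 - η) * (k : ℝ) ^ α := by ring
  rw [this, Real.exp_add, weight]
  ring

lemma tsum_weight {α : ℝ} (hα : 0 < α) : ∑' k, weight α k = 1 := by
  unfold weight
  rw [tsum_mul_left, normConst]
  refine one_div_mul_cancel (ne_of_gt ?_)
  exact (summable_exp_neg_rpow hα).tsum_pos (fun _ => (Real.exp_pos _).le) 0 (Real.exp_pos _)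

lemma summable_weight {α : ℝ} (hα : 0 < α) : Summable (weight α) :=
  (summable_exp_neg_rpow hα).mul_left _

lemma summable_weight_mul_pow {α : ℝ} (hα : 0 < α) (r : ℕ) :
    Summable fun k : ℕ => weight α k * (k : ℝ) ^ r := by
  refine summable_weight_mul hα one_pos (C := 1) (r := r) (by positivity) fun k => ?_
  simp only [sub_self, zero_mul, Real.exp_zero, one_mul, mul_one, Real.rpow_natCast]
  rw [abs_of_nonneg (by positivity)]
  gcongr
  linarith

/-- The truncated exponential weight `exp (a n^(γ-1) (k - m))` for `k ≤ ε n^γ`; larger values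
get the weight `b exp ((1 - η) k^α)`, up to the centering. -/
def tilt (α m γ ε η b a : ℝ) (n k : ℕ) : ℝ :=
  if (k : ℝ) ≤ ε * (n : ℝ) ^ γ then Real.exp (a * (n : ℝ) ^ (γ - 1) * (k - m))
  else b * Real.exp ((1 - η) * (k : ℝ) ^ α - a * (n : ℝ) ^ (γ - 1) * m)

lemma tilt_nonneg {α m γ ε η b a : ℝ} (hb : 0 ≤ b) (n k : ℕ) : 0 ≤ tilt α m γ ε η b a n k := by
  unfold tilt
  split_ifs <;> positivity

lemma abs_exp_sub_one_sub_le (u : ℝ) : |Real.exp u - 1 - u| ≤ u ^ 2 * Real.exp |u| := by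
  have h := Complex.norm_exp_sub_sum_le_norm_mul_exp (u : ℂ) 2
  rw [Finset.sum_range_succ, Finset.sum_range_one] at h
  simp only [pow_zero, Nat.factorial_zero, Nat.cast_one, div_one, pow_one, Nat.factorial_one,
    Complex.norm_real, Real.norm_eq_abs, sq_abs] at h
  rw [← sub_sub] at h
  have e : Complex.exp (u : ℂ) - 1 - u = ((Real.exp u - 1 - u : ℝ) : ℂ) := by push_cast; rfl
  rwa [e, Complex.norm_real, Real.norm_eq_abs] at h

lemma tendsto_exp_sub_one_sub_div_sq (v : ℝ) :
    Tendsto (fun r : ℝ => (Real.exp (v * r) - 1 - v * r) / r ^ 2) (𝓝[≠] 0) (𝓝 (v ^ 2 / 2)) := by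
  have h := (Real.exp_sub_sum_range_succ_isLittleO_pow 2).comp_tendsto
    ((continuous_const_mul v).tendsto' 0 0 (mul_zero v))
  have h' : (fun r : ℝ => Real.exp (v * r) - 1 - v * r - v ^ 2 / 2 * r ^ 2) =o[𝓝 0]
      fun r : ℝ => r ^ 2 := by
    have h2 : ((fun x : ℝ => x ^ 2) ∘ fun r => v * r) =O[𝓝 0] fun r : ℝ => r ^ 2 :=
      Asymptotics.IsBigO.of_bound (v ^ 2) (Eventually.of_forall fun r => by
        simp [mul_pow])
    refine (h.trans_isBigO h2).congr_left fun r => ?_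
    simp [Finset.sum_range_succ]
    ring
  have ht := (h'.mono (nhdsWithin_le_nhds (s := {0}ᶜ))).tendsto_div_nhds_zero
  rw [← tendsto_sub_nhds_zero_iff]
  refine ht.congr' ?_
  filter_upwards [self_mem_nhdsWithin] with r hr
  have hr' : r ≠ 0 := hr
  field_simp

/-! ### Scaling exponents and the domination bound -/

section Exponents

variable {α γ : ℝ}

lemma gamma_pos (hα₁ : α < 1) (hγ : γ = 1 / (2 - α)) : 0 < γ := by
  rw [hγ]; exact one_div_pos.2 (by linarith)

lemma gamma_lt_one (hα₁ : α < 1) (hγ : γ = 1 / (2 - α)) : γ < 1 := by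
  rw [hγ, div_lt_one] <;> linarith

/-- The balance that singles out `γ`: the jump cost `n^(γα)` and the Gaussian cost `n^(2γ-1)` have
the same order. -/
lemma gamma_mul_alpha (hα₁ : α < 1) (hγ : γ = 1 / (2 - α)) : γ * α = 2 * γ - 1 := by
  have : (2 - α) ≠ 0 := by linarith
  rw [hγ]; field_simp; ring

lemma tendsto_natCast_rpow_sub_one (hα₁ : α < 1) (hγ : γ = 1 / (2 - α)) :
    Tendsto (fun n : ℕ => (n : ℝ) ^ (γ - 1)) atTop (𝓝 0) := by
  have h := (tendsto_rpow_neg_atTop (y := 1 - γ) (by linarith [gamma_lt_one hα₁ hγ])).comp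
    (tendsto_natCast_atTop_atTop (R := ℝ))
  simpa [Function.comp_def] using h

lemma tendsto_natCast_rpow_gamma (hα₁ : α < 1) (hγ : γ = 1 / (2 - α)) :
    Tendsto (fun n : ℕ => (n : ℝ) ^ γ) atTop atTop :=
  (tendsto_rpow_atTop (gamma_pos hα₁ hγ)).comp tendsto_natCast_atTop_atTop

lemma tendsto_natCast_rpow_gamma_mul_alpha (hα₀ : 0 < α) (hα₁ : α < 1) (hγ : γ = 1 / (2 - α)) :
    Tendsto (fun n : ℕ => (n : ℝ) ^ (γ * α)) atTop atTop :=
  (tendsto_rpow_atTop (mul_pos (gamma_pos hα₁ hγ) hα₀)).comp tendsto_natCast_atTop_atTop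

/-- Below the truncation level the linear exponent is dominated by half of the logarithmic
tail. -/
lemma abs_mul_rpow_mul_le (hα₁ : α < 1) (hγ : γ = 1 / (2 - α)) {a ε : ℝ}
    (hε : 0 < ε) (ha : |a| * ε ^ (1 - α) ≤ 1 / 2) {n k : ℕ} (hn : 1 ≤ n)
    (hk : (k : ℝ) ≤ ε * (n : ℝ) ^ γ) :
    |a| * (n : ℝ) ^ (γ - 1) * k ≤ (k : ℝ) ^ α / 2 := by
  have hn' : (0 : ℝ) < n := by exact_mod_cast hn
  have hk0 : (0 : ℝ) ≤ k := Nat.cast_nonneg k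
  have hk1 : (k : ℝ) = (k : ℝ) ^ α * (k : ℝ) ^ (1 - α) := by
    rw [← Real.rpow_add' hk0 (by simp)]; simp
  have hk2 : (k : ℝ) ^ (1 - α) ≤ ε ^ (1 - α) * (n : ℝ) ^ (γ * (1 - α)) := by
    rw [Real.rpow_mul hn'.le, ← Real.mul_rpow hε.le (by positivity)]
    exact Real.rpow_le_rpow hk0 hk (by linarith)
  have hn1 : (n : ℝ) ^ (γ - 1) * (n : ℝ) ^ (γ * (1 - α)) = 1 := by
    rw [← Real.rpow_add hn', show γ - 1 + γ * (1 - α) = 0 by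
      linarith [gamma_mul_alpha hα₁ hγ], Real.rpow_zero]
  calc |a| * (n : ℝ) ^ (γ - 1) * k
      = |a| * (n : ℝ) ^ (γ - 1) * ((k : ℝ) ^ α * (k : ℝ) ^ (1 - α)) := by rw [← hk1]
    _ ≤ |a| * (n : ℝ) ^ (γ - 1) * ((k : ℝ) ^ α * (ε ^ (1 - α) * (n : ℝ) ^ (γ * (1 - α)))) := by
        gcongr
    _ = (|a| * ε ^ (1 - α)) * (k : ℝ) ^ α * ((n : ℝ) ^ (γ - 1) * (n : ℝ) ^ (γ * (1 - α))) := by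
        ring
    _ ≤ 1 / 2 * (k : ℝ) ^ α * 1 := by rw [hn1]; gcongr
    _ = _ := by ring

set_option maxHeartbeats 400000 in
/-- A summable majorant for the second order remainder of `tilt`. -/
lemma exists_tilt_remainder_bound (hα₁ : α < 1) (hγ : γ = 1 / (2 - α)) {m ε η b a : ℝ}
    (hm : 0 ≤ m) (hε : 0 < ε) (hη' : η ≤ 1 / 2)
    (hb₀ : 0 ≤ b) (hb₁ : b ≤ 1) (ha : |a| * ε ^ (1 - α) ≤ 1 / 2) :
    ∃ C r : ℝ, 0 ≤ r ∧ ∀ n : ℕ, 1 ≤ n → ∀ k : ℕ,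
      |(n : ℝ) ^ (2 - 2 * γ) *
        (tilt α m γ ε η b a n k - 1 - a * (n : ℝ) ^ (γ - 1) * (k - m))| ≤
      C * (1 + (k : ℝ)) ^ r * Real.exp ((1 - η) * (k : ℝ) ^ α) := by
  have hγ0 := gamma_pos hα₁ hγ
  have hγ1 := gamma_lt_one hα₁ hγ
  -- Above the truncation level `n^γ < k / ε`, hence the prefactor `n^(2-2γ) = (n^γ)^q` is at most
  -- polynomial in `k`.
  set q := (2 - 2 * γ) / γ with hq
  have hq0 : 0 ≤ q := div_nonneg (by linarith) hγ0.le
  have hqγ : γ * q = 2 - 2 * γ := by rw [hq]; field_simp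
  -- `C₁` serves the values below the truncation level, `C₂` those above it.
  set C₁ := a ^ 2 * (1 + m) ^ 2 * Real.exp (|a| * m) with hC₁
  set C₂ := (1 / ε) ^ q * ((1 + |a| * (1 + m)) + Real.exp (|a| * m)) with hC₂
  have hC₁0 : 0 ≤ C₁ := by positivity
  have hC₂0 : 0 ≤ C₂ := by positivity
  refine ⟨C₁ + C₂, q + 2, by linarith, fun n hn k => ?_⟩
  have hn' : (0 : ℝ) < n := by exact_mod_cast hn
  have hn1 : (1 : ℝ) ≤ n := by exact_mod_cast hn
  have hk0 : (0 : ℝ) ≤ k := Nat.cast_nonneg k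
  have hr1 : (n : ℝ) ^ (γ - 1) ≤ 1 := Real.rpow_le_one_of_one_le_of_nonpos hn1 (by linarith)
  have hr0 : 0 < (n : ℝ) ^ (γ - 1) := by positivity
  have hkm : |(k : ℝ) - m| ≤ k + m := by
    rw [abs_le]; constructor <;> linarith
  have hkm' : (k : ℝ) + m ≤ (1 + m) * (1 + k) := by nlinarith
  have hpow : (n : ℝ) ^ (2 - 2 * γ) * ((n : ℝ) ^ (γ - 1)) ^ 2 = 1 := by
    rw [← Real.rpow_natCast ((n : ℝ) ^ (γ - 1)), ← Real.rpow_mul hn'.le, ← Real.rpow_add hn']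
    norm_num
    rw [show 2 - 2 * γ + (γ - 1) * 2 = 0 by ring, Real.rpow_zero]
  have hk2 : (1 + (k : ℝ)) ^ (2 : ℝ) ≤ (1 + (k : ℝ)) ^ (q + 2) :=
    Real.rpow_le_rpow_of_exponent_le (by linarith) (by linarith)
  have hk3 : (1 + (k : ℝ)) ^ (q + 1) ≤ (1 + (k : ℝ)) ^ (q + 2) :=
    Real.rpow_le_rpow_of_exponent_le (by linarith) (by linarith)
  have hk4 : (1 + (k : ℝ)) ^ q ≤ (1 + (k : ℝ)) ^ (q + 2) :=
    Real.rpow_le_rpow_of_exponent_le (by linarith) (by linarith)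
  -- Because `η ≤ 1/2`, the exponent `k^α / 2` allowed below the level fits under the majorant used
  -- above it.
  have hη1 : (k : ℝ) ^ α / 2 ≤ (1 - η) * (k : ℝ) ^ α := by
    have : (0 : ℝ) ≤ (k : ℝ) ^ α := by positivity
    nlinarith
  have hexp1 : 1 ≤ Real.exp ((1 - η) * (k : ℝ) ^ α) := by
    apply Real.one_le_exp
    have : (0 : ℝ) ≤ (k : ℝ) ^ α := by positivity
    nlinarith
  unfold tilt
  split_ifs with hk
  · set u := a * (n : ℝ) ^ (γ - 1) * (k - m) with hu
    have habs : |u| ≤ (1 - η) * (k : ℝ) ^ α + |a| * m := by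
      have h1 := abs_mul_rpow_mul_le hα₁ hγ hε ha hn hk
      have h2 : |a| * (n : ℝ) ^ (γ - 1) * m ≤ |a| * 1 * m := by gcongr
      have h3 : |u| ≤ |a| * (n : ℝ) ^ (γ - 1) * (k + m) := by
        rw [hu, abs_mul, abs_mul, abs_of_pos hr0]
        gcongr
      nlinarith
    have hu2 : (n : ℝ) ^ (2 - 2 * γ) * u ^ 2 = a ^ 2 * (k - m) ^ 2 := by
      rw [hu, mul_pow, mul_pow]
      calc _ = ((n : ℝ) ^ (2 - 2 * γ) * ((n : ℝ) ^ (γ - 1)) ^ 2) * (a ^ 2 * (k - m) ^ 2) := by ring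
        _ = _ := by rw [hpow, one_mul]
    rw [abs_mul, abs_of_pos (by positivity : 0 < (n : ℝ) ^ (2 - 2 * γ))]
    calc (n : ℝ) ^ (2 - 2 * γ) * |Real.exp u - 1 - u|
        ≤ (n : ℝ) ^ (2 - 2 * γ) * (u ^ 2 * Real.exp |u|) := by
          gcongr; exact abs_exp_sub_one_sub_le u
      _ = a ^ 2 * (k - m) ^ 2 * Real.exp |u| := by rw [← mul_assoc, hu2]
      _ ≤ a ^ 2 * ((1 + m) * (1 + k)) ^ 2 * (Real.exp ((1 - η) * (k : ℝ) ^ α) *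
            Real.exp (|a| * m)) := by
          rw [← Real.exp_add, ← sq_abs ((k : ℝ) - m)]
          gcongr
          exact hkm.trans hkm'
      _ = C₁ * (1 + (k : ℝ)) ^ (2 : ℝ) * Real.exp ((1 - η) * (k : ℝ) ^ α) := by
          rw [hC₁, Real.rpow_two]; ring
      _ ≤ (C₁ + C₂) * (1 + (k : ℝ)) ^ (q + 2) * Real.exp ((1 - η) * (k : ℝ) ^ α) := by
          gcongr; linarith
  · have hk' : ε * (n : ℝ) ^ γ < k := not_le.1 hk
    have hnq : (n : ℝ) ^ (2 - 2 * γ) ≤ (1 / ε) ^ q * (1 + (k : ℝ)) ^ q := by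
      rw [← hqγ, Real.rpow_mul hn'.le, ← Real.mul_rpow (by positivity) (by positivity)]
      refine Real.rpow_le_rpow (by positivity) ?_ hq0
      rw [one_div_mul_eq_div, le_div_iff₀ hε]
      linarith
    set E := Real.exp ((1 - η) * (k : ℝ) ^ α) with hE
    have h1 : |b * Real.exp ((1 - η) * (k : ℝ) ^ α - a * (n : ℝ) ^ (γ - 1) * m)| ≤
        E * Real.exp (|a| * m) := by
      rw [abs_of_nonneg (by positivity), hE, ← Real.exp_add]
      refine (mul_le_of_le_one_left (Real.exp_pos _).le hb₁).trans (Real.exp_le_exp.2 ?_)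
      have h2 : -(a * (n : ℝ) ^ (γ - 1) * m) ≤ |a| * 1 * m := by
        refine (neg_le_abs _).trans ?_
        rw [abs_mul, abs_mul, abs_of_pos hr0, abs_of_nonneg hm]
        gcongr
      linarith
    have h2 : |a * (n : ℝ) ^ (γ - 1) * (k - m)| ≤ |a| * ((1 + m) * (1 + k)) := by
      rw [abs_mul, abs_mul, abs_of_pos hr0]
      calc |a| * (n : ℝ) ^ (γ - 1) * |(k : ℝ) - m| ≤ |a| * 1 * ((1 + m) * (1 + k)) := by
            gcongr; exact hkm.trans hkm'
        _ = _ := by ring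
    have h3 : |b * Real.exp ((1 - η) * (k : ℝ) ^ α - a * (n : ℝ) ^ (γ - 1) * m) - 1 -
        a * (n : ℝ) ^ (γ - 1) * (k - m)| ≤
        ((1 + |a| * (1 + m)) + Real.exp (|a| * m)) * (1 + k) * E := by
      refine (abs_sub _ _).trans ?_
      refine (add_le_add ((abs_sub _ _).trans (add_le_add h1 (abs_one).le)) h2).trans ?_
      have hkE : E ≤ (1 + (k : ℝ)) * E := le_mul_of_one_le_left (Real.exp_pos _).le (by linarith)
      have hkE' : 1 + (k : ℝ) ≤ (1 + (k : ℝ)) * E := le_mul_of_one_le_right (by positivity) hexp1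
      have e1 := mul_le_mul_of_nonneg_right hkE (Real.exp_pos (|a| * m)).le
      have e2 := mul_le_mul_of_nonneg_left hkE' (by positivity : 0 ≤ |a| * (1 + m))
      have e3 : ((1 + |a| * (1 + m)) + Real.exp (|a| * m)) * (1 + k) * E = (1 + (k : ℝ)) * E +
          |a| * (1 + m) * ((1 + (k : ℝ)) * E) + (1 + (k : ℝ)) * E * Real.exp (|a| * m) := by ring
      have e4 : |a| * ((1 + m) * (1 + k)) = |a| * (1 + m) * (1 + (k : ℝ)) := by ring
      rw [e3, e4]
      linarith
    rw [abs_mul, abs_of_pos (by positivity : 0 < (n : ℝ) ^ (2 - 2 * γ))]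
    have hEpos : 0 < E := Real.exp_pos _
    calc _ ≤ ((1 / ε) ^ q * (1 + (k : ℝ)) ^ q) *
          (((1 + |a| * (1 + m)) + Real.exp (|a| * m)) * (1 + k) * E) := by
          gcongr
      _ = C₂ * ((1 + (k : ℝ)) ^ q * (1 + k)) * E := by rw [hC₂]; ring
      _ = C₂ * (1 + (k : ℝ)) ^ (q + 1) * E := by
          rw [Real.rpow_add_one (by positivity)]
      _ ≤ (C₁ + C₂) * (1 + (k : ℝ)) ^ (q + 2) * E := by
          gcongr; linarith

end Exponents

/-- The expectation of `tilt` under the stretched exponential law. -/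
def tiltMean (α m γ ε η b a : ℝ) (n : ℕ) : ℝ := ∑' k, weight α k * tilt α m γ ε η b a n k

/-! ### Second order asymptotics of the tilted mean -/

section TiltMean

variable {α γ : ℝ}

lemma summable_weight_mul_sub {α : ℝ} (hα₀ : 0 < α) (m : ℝ) :
    Summable fun k : ℕ => weight α k * ((k : ℝ) - m) := by
  have h1 := summable_weight_mul_pow hα₀ 1
  simp only [pow_one] at h1
  simpa only [mul_sub] using h1.sub ((summable_weight hα₀).mul_right m)

lemma summable_weight_mul_tilt (hα₀ : 0 < α) (hα₁ : α < 1) (hγ : γ = 1 / (2 - α)) {m ε η b a : ℝ}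
    (hm : 0 ≤ m) (hε : 0 < ε) (hη : 0 < η) (hη' : η ≤ 1 / 2)
    (hb₀ : 0 ≤ b) (hb₁ : b ≤ 1) (ha : |a| * ε ^ (1 - α) ≤ 1 / 2) {n : ℕ} (hn : 1 ≤ n) :
    Summable fun k => weight α k * tilt α m γ ε η b a n k := by
  obtain ⟨C, r, hr, hC⟩ := exists_tilt_remainder_bound hα₁ hγ hm hε hη' hb₀ hb₁ ha
  have hn' : (0 : ℝ) < n := by exact_mod_cast hn
  have h := (summable_weight_mul hα₀ hη hr (hC n hn)).mul_left ((n : ℝ) ^ (2 - 2 * γ))⁻¹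
  refine ((h.add (summable_weight hα₀)).add
    ((summable_weight_mul_sub hα₀ m).mul_left (a * (n : ℝ) ^ (γ - 1)))).congr fun k => ?_
  have : (n : ℝ) ^ (2 - 2 * γ) ≠ 0 := by positivity
  field_simp
  ring

/-- The linear Taylor term has mean zero because `m` is the mean of the law. The rescaled remainder
tends to `(a (k - m))² / 2` for each fixed `k`, since `k` eventually lies below the truncation
level; therefore `b` and `η` leave no trace in the limit. Dominated convergence applies by
`exists_tilt_remainder_bound`. -/
lemma tendsto_tiltMean (hα₀ : 0 < α) (hα₁ : α < 1) (hγ : γ = 1 / (2 - α)) {m v ε η b a : ℝ}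
    (hm : ∑' k : ℕ, weight α k * (k : ℝ) = m)
    (hv : ∑' k : ℕ, weight α k * ((k : ℝ) - m) ^ 2 = v) (hε : 0 < ε) (hη : 0 < η)
    (hη' : η ≤ 1 / 2) (hb₀ : 0 ≤ b) (hb₁ : b ≤ 1) (ha : |a| * ε ^ (1 - α) ≤ 1 / 2) :
    Tendsto (fun n : ℕ => (n : ℝ) ^ (2 - 2 * γ) * (tiltMean α m γ ε η b a n - 1)) atTop
      (𝓝 (a ^ 2 * v / 2)) := by
  have hm0 : 0 ≤ m := hm ▸ tsum_nonneg fun k => mul_nonneg (weight_pos hα₀ k).le (by positivity)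
  obtain ⟨C, r, hr, hC⟩ := exists_tilt_remainder_bound hα₁ hγ hm0 hε hη' hb₀ hb₁ ha
  have hr1 := tendsto_natCast_rpow_sub_one hα₁ hγ
  have hlim : Tendsto (fun n : ℕ => ∑' k, weight α k * ((n : ℝ) ^ (2 - 2 * γ) *
      (tilt α m γ ε η b a n k - 1 - a * (n : ℝ) ^ (γ - 1) * (k - m)))) atTop
      (𝓝 (∑' k : ℕ, weight α k * ((a * (k - m)) ^ 2 / 2))) := by
    refine tendsto_tsum_of_dominated_convergence
      (bound := fun k => weight α k * (C * (1 + (k : ℝ)) ^ r * Real.exp ((1 - η) * (k : ℝ) ^ α)))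
      ?_ (fun k => ?_) ?_
    · refine summable_weight_mul hα₀ hη (C := |C|) hr fun k => ?_
      rw [abs_mul, abs_mul, abs_of_pos (Real.exp_pos _),
        abs_of_nonneg (by positivity : 0 ≤ (1 + (k : ℝ)) ^ r)]
    · refine Tendsto.const_mul _ ?_
      have hne : Tendsto (fun n : ℕ => (n : ℝ) ^ (γ - 1)) atTop (𝓝[≠] 0) := by
        refine tendsto_nhdsWithin_iff.2 ⟨hr1, ?_⟩
        filter_upwards [eventually_ge_atTop 1] with n hn
        have hn' : (0 : ℝ) < n := by exact_mod_cast hn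
        exact (Real.rpow_pos_of_pos hn' _).ne'
      refine ((tendsto_exp_sub_one_sub_div_sq (a * (k - m))).comp hne).congr' ?_
      filter_upwards [eventually_ge_atTop 1,
        (tendsto_natCast_rpow_gamma hα₁ hγ).eventually_ge_atTop (k / ε)] with n hn hkn
      have hn' : (0 : ℝ) < n := by exact_mod_cast hn
      have hk : (k : ℝ) ≤ ε * (n : ℝ) ^ γ := by
        rw [div_le_iff₀ hε] at hkn; linarith
      have hp : (n : ℝ) ^ (2 - 2 * γ) = (((n : ℝ) ^ (γ - 1)) ^ 2)⁻¹ := by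
        rw [← Real.rpow_natCast ((n : ℝ) ^ (γ - 1)), ← Real.rpow_mul hn'.le, ← Real.rpow_neg hn'.le]
        congr 1
        push_cast
        ring
      simp only [Function.comp_apply, tilt, if_pos hk, hp]
      rw [show a * ((k : ℝ) - m) * (n : ℝ) ^ (γ - 1) = a * (n : ℝ) ^ (γ - 1) * (k - m) by ring]
      rw [div_eq_inv_mul]
    · filter_upwards [eventually_ge_atTop 1] with n hn k
      rw [Real.norm_eq_abs, abs_mul, abs_of_pos (weight_pos hα₀ k)]
      exact mul_le_mul_of_nonneg_left (hC n hn k) (weight_pos hα₀ k).le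
  have hval : ∑' k : ℕ, weight α k * ((a * (k - m)) ^ 2 / 2) = a ^ 2 * v / 2 := by
    rw [← hv, ← tsum_mul_left, ← tsum_div_const]
    exact tsum_congr fun k => by ring
  rw [hval] at hlim
  refine hlim.congr' ?_
  filter_upwards [eventually_ge_atTop 1] with n hn
  have hs := summable_weight_mul_tilt hα₀ hα₁ hγ hm0 hε hη hη' hb₀ hb₁ ha hn
  have h0 : ∑' k : ℕ, weight α k * ((k : ℝ) - m) = 0 := by
    have h1 := summable_weight_mul_pow hα₀ 1
    simp only [pow_one] at h1
    simp only [mul_sub]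
    rw [h1.tsum_sub ((summable_weight hα₀).mul_right m), tsum_mul_right, tsum_weight hα₀, hm]
    ring
  have h1 : tiltMean α m γ ε η b a n - 1 = ∑' k, weight α k *
      (tilt α m γ ε η b a n k - 1 - a * (n : ℝ) ^ (γ - 1) * (k - m)) := by
    have hs' := (summable_weight_mul_sub hα₀ m).mul_left (a * (n : ℝ) ^ (γ - 1))
    have e := (hs.sub (summable_weight hα₀)).tsum_sub hs'
    rw [hs.tsum_sub (summable_weight hα₀), tsum_mul_left, h0, tsum_weight hα₀, mul_zero,
      sub_zero] at e
    rw [tiltMean, ← e]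
    exact tsum_congr fun k => by ring
  rw [h1, ← tsum_mul_left]
  exact tsum_congr fun k => by ring

/-- The cumulant asymptotics for `N n ∼ n` independent variables. -/
lemma tendsto_mul_log_tiltMean (hα₀ : 0 < α) (hα₁ : α < 1) (hγ : γ = 1 / (2 - α))
    {m v ε η b a : ℝ} (hm : ∑' k : ℕ, weight α k * (k : ℝ) = m)
    (hv : ∑' k : ℕ, weight α k * ((k : ℝ) - m) ^ 2 = v) (hε : 0 < ε) (hη : 0 < η)
    (hη' : η ≤ 1 / 2) (hb₀ : 0 ≤ b) (hb₁ : b ≤ 1) (ha : |a| * ε ^ (1 - α) ≤ 1 / 2)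
    {N : ℕ → ℕ} (hN : Tendsto (fun n => (N n : ℝ) / n) atTop (𝓝 1)) :
    (∀ᶠ n in atTop, 0 < tiltMean α m γ ε η b a n) ∧
    Tendsto (fun n : ℕ => N n * Real.log (tiltMean α m γ ε η b a n) / (n : ℝ) ^ (γ * α)) atTop
      (𝓝 (a ^ 2 * v / 2)) := by
  have h := tendsto_tiltMean hα₀ hα₁ hγ hm hv hε hη hη' hb₀ hb₁ ha
  set M := tiltMean α m γ ε η b a
  have hpow : ∀ n : ℕ, 1 ≤ n → (n : ℝ) ^ (2 - 2 * γ) = ((n : ℝ) ^ (γ - 1) * (n : ℝ) ^ (γ - 1))⁻¹ := by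
    intro n hn
    have hn' : (0 : ℝ) < n := by exact_mod_cast hn
    rw [← Real.rpow_add hn', ← Real.rpow_neg hn'.le]
    congr 1; ring
  have hr1 := tendsto_natCast_rpow_sub_one hα₁ hγ
  have hM1 : Tendsto M atTop (𝓝 1) := by
    have h2 := ((hr1.mul hr1).mul h).add_const 1
    rw [mul_zero, zero_mul, zero_add] at h2
    refine h2.congr' ?_
    filter_upwards [eventually_ge_atTop 1] with n hn
    have hn' : (0 : ℝ) < n := by exact_mod_cast hn
    have : (n : ℝ) ^ (γ - 1) ≠ 0 := by positivity
    rw [hpow n hn]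
    field_simp
    ring
  have hMpos : ∀ᶠ n in atTop, 0 < M n := hM1.eventually_const_lt one_pos
  refine ⟨hMpos, ?_⟩
  -- The logarithm is squeezed between `1 - M⁻¹` and `M - 1`, which agree to leading order because
  -- `M → 1`.
  have hlow : Tendsto (fun n : ℕ => (n : ℝ) ^ (2 - 2 * γ) * (1 - (M n)⁻¹)) atTop
      (𝓝 (a ^ 2 * v / 2)) := by
    have h2 := h.mul (hM1.inv₀ one_ne_zero)
    rw [inv_one, mul_one] at h2
    refine h2.congr' ?_
    filter_upwards [hMpos] with n hn
    field_simp
  have hlog : Tendsto (fun n : ℕ => (n : ℝ) ^ (2 - 2 * γ) * Real.log (M n)) atTop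
      (𝓝 (a ^ 2 * v / 2)) := by
    refine tendsto_of_tendsto_of_tendsto_of_le_of_le' hlow h ?_ ?_
    · filter_upwards [hMpos] with n hn
      exact mul_le_mul_of_nonneg_left (Real.one_sub_inv_le_log_of_pos hn) (by positivity)
    · filter_upwards [hMpos] with n hn
      exact mul_le_mul_of_nonneg_left (Real.log_le_sub_one_of_pos hn) (by positivity)
  have h3 := hN.mul hlog
  rw [one_mul] at h3
  refine h3.congr' ?_
  filter_upwards [eventually_ge_atTop 1] with n hn
  have hn' : (0 : ℝ) < n := by exact_mod_cast hn
  have e : (n : ℝ) ^ (2 - 2 * γ) = n / (n : ℝ) ^ (γ * α) := by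
    rw [gamma_mul_alpha hα₁ hγ, eq_div_iff (by positivity), ← Real.rpow_add hn']
    ring_nf
    simp
  rw [e]
  field_simp

lemma eventually_tiltMean_pow_bounds (hα₀ : 0 < α) (hα₁ : α < 1) (hγ : γ = 1 / (2 - α))
    {m v ε η b a : ℝ} (hm : ∑' k : ℕ, weight α k * (k : ℝ) = m)
    (hv : ∑' k : ℕ, weight α k * ((k : ℝ) - m) ^ 2 = v) (hε : 0 < ε) (hη : 0 < η)
    (hη' : η ≤ 1 / 2) (hb₀ : 0 ≤ b) (hb₁ : b ≤ 1) (ha : |a| * ε ^ (1 - α) ≤ 1 / 2)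
    {N : ℕ → ℕ} (hN : Tendsto (fun n => (N n : ℝ) / n) atTop (𝓝 1)) {δ : ℝ} (hδ : 0 < δ) :
    ∀ᶠ n : ℕ in atTop,
      Real.exp ((n : ℝ) ^ (γ * α) * (a ^ 2 * v / 2 - δ)) ≤ tiltMean α m γ ε η b a n ^ N n ∧
      tiltMean α m γ ε η b a n ^ N n ≤ Real.exp ((n : ℝ) ^ (γ * α) * (a ^ 2 * v / 2 + δ)) := by
  obtain ⟨hpos, hlim⟩ := tendsto_mul_log_tiltMean hα₀ hα₁ hγ hm hv hε hη hη' hb₀ hb₁ ha hN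
  filter_upwards [hpos, hlim.eventually_const_le (by linarith : a ^ 2 * v / 2 - δ < a ^ 2 * v / 2),
    hlim.eventually_le_const (by linarith : a ^ 2 * v / 2 < a ^ 2 * v / 2 + δ),
    eventually_ge_atTop 1] with n hn h1 h2 hn1
  have hn' : (0 : ℝ) < n := by exact_mod_cast hn1
  have hp : 0 < (n : ℝ) ^ (γ * α) := by positivity
  have e : tiltMean α m γ ε η b a n ^ N n =
      Real.exp (N n * Real.log (tiltMean α m γ ε η b a n)) := by
    rw [mul_comm, Real.exp_mul, Real.exp_log hn, Real.rpow_natCast]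
  rw [le_div_iff₀ hp] at h1
  rw [div_le_iff₀ hp] at h2
  rw [e]
  exact ⟨Real.exp_le_exp.2 (by linarith), Real.exp_le_exp.2 (by linarith)⟩

end TiltMean

/-! ### Moments, independence and measurability -/

section Law

variable {Ω : Type*} [MeasurableSpace Ω] {P : Measure Ω} {α : ℝ} {X : ℕ → Ω → ℕ}

lemma IsIIDStretchedExp.lintegral_comp (hX : IsIIDStretchedExp P α X) (i : ℕ) (g : ℕ → ℝ≥0∞) :
    ∫⁻ ω, g (X i ω) ∂P = ∑' k, g k * ENNReal.ofReal (weight α k) := by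
  rw [← lintegral_map (μ := P) (f := g) (g := X i) (measurable_of_countable _) (hX.measurable i),
    lintegral_countable']
  refine tsum_congr fun k => ?_
  rw [Measure.map_apply (hX.measurable i) (measurableSet_singleton k)]
  exact congrArg _ (hX.law i k)

lemma IsIIDStretchedExp.lintegral_ofReal_comp (hα : 0 < α) (hX : IsIIDStretchedExp P α X) (i : ℕ)
    {g : ℕ → ℝ} (hg : ∀ k, 0 ≤ g k) (hs : Summable fun k => weight α k * g k) :
    ∫⁻ ω, ENNReal.ofReal (g (X i ω)) ∂P = ENNReal.ofReal (∑' k, weight α k * g k) := by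
  rw [hX.lintegral_comp i fun k => ENNReal.ofReal (g k),
    ENNReal.ofReal_tsum_of_nonneg (fun k => mul_nonneg (weight_pos hα k).le (hg k)) hs]
  refine tsum_congr fun k => ?_
  rw [ENNReal.ofReal_mul (weight_pos hα k).le, mul_comm]

lemma IsIIDStretchedExp.integral_comp (hα : 0 < α) (hX : IsIIDStretchedExp P α X) (i : ℕ)
    {g : ℕ → ℝ} (hg : ∀ k, 0 ≤ g k) (hs : Summable fun k => weight α k * g k) :
    ∫ ω, g (X i ω) ∂P = ∑' k, weight α k * g k := by
  rw [integral_eq_lintegral_of_nonneg_ae (Eventually.of_forall fun ω => hg _)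
    ((measurable_of_countable g).comp (hX.measurable i)).aestronglyMeasurable,
    hX.lintegral_ofReal_comp hα i hg hs, ENNReal.toReal_ofReal]
  exact tsum_nonneg fun k => mul_nonneg (weight_pos hα k).le (hg k)

lemma IsIIDStretchedExp.integral_eq (hα : 0 < α) (hX : IsIIDStretchedExp P α X) (i : ℕ) :
    ∫ ω, (X i ω : ℝ) ∂P = ∑' k : ℕ, weight α k * (k : ℝ) :=
  hX.integral_comp hα i (fun k => Nat.cast_nonneg k) (by simpa using summable_weight_mul_pow hα 1)

lemma summable_weight_mul_sq_sub (hα : 0 < α) (m : ℝ) :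
    Summable fun k : ℕ => weight α k * ((k : ℝ) - m) ^ 2 := by
  refine (((summable_weight_mul_pow hα 2).add
    ((summable_weight_mul_pow hα 1).mul_left (-2 * m))).add
    ((summable_weight hα).mul_left (m ^ 2))).congr fun k => ?_
  ring

lemma IsIIDStretchedExp.variance_eq (hα : 0 < α) (hX : IsIIDStretchedExp P α X) (i : ℕ) :
    Var[fun ω => (X i ω : ℝ); P] =
      ∑' k : ℕ, weight α k * ((k : ℝ) - ∫ ω, (X i ω : ℝ) ∂P) ^ 2 := by
  have hmeas : Measurable fun ω => (X i ω : ℝ) :=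
    (measurable_of_countable fun k : ℕ => (k : ℝ)).comp (hX.measurable i)
  rw [variance_eq_integral hmeas.aemeasurable]
  exact hX.integral_comp hα i (g := fun k => ((k : ℝ) - ∫ ω, (X i ω : ℝ) ∂P) ^ 2)
    (fun k => sq_nonneg _) (summable_weight_mul_sq_sub hα _)

lemma tsum_weight_mul_sq_sub_pos (hα : 0 < α) (m : ℝ) :
    0 < ∑' k : ℕ, weight α k * ((k : ℝ) - m) ^ 2 := by
  have h0 : ∀ k : ℕ, 0 ≤ weight α k * ((k : ℝ) - m) ^ 2 := fun k =>
    mul_nonneg (weight_pos hα k).le (sq_nonneg _)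
  obtain ⟨k, hk⟩ : ∃ k : ℕ, (k : ℝ) - m ≠ 0 := by
    by_contra! h
    have h1 := h 0
    have h2 := h 1
    push_cast at h1 h2
    linarith
  have hk2 : 0 < ((k : ℝ) - m) ^ 2 := by positivity
  exact (summable_weight_mul_sq_sub hα m).tsum_pos h0 k (mul_pos (weight_pos hα k) hk2)

lemma IsIIDStretchedExp.lintegral_prod (hα : 0 < α) (hX : IsIIDStretchedExp P α X)
    (B : Finset ℕ) {g : ℕ → ℝ} (hg : ∀ k, 0 ≤ g k) (hs : Summable fun k => weight α k * g k) :
    ∫⁻ ω, ENNReal.ofReal (∏ i ∈ B, g (X i ω)) ∂P =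
      ENNReal.ofReal ((∑' k, weight α k * g k) ^ B.card) := by
  have h := lintegral_prod_eq_prod_lintegral_of_indepFun (μ := P) B
    (fun i ω => ENNReal.ofReal (g (X i ω)))
    (hX.indep.comp (fun _ k => ENNReal.ofReal (g k)) fun _ => measurable_of_countable _)
    (fun i => (measurable_of_countable (fun k => ENNReal.ofReal (g k))).comp (hX.measurable i))
  have e : ∀ ω, ENNReal.ofReal (∏ i ∈ B, g (X i ω)) = ∏ i ∈ B, ENNReal.ofReal (g (X i ω)) :=
    fun ω => ENNReal.ofReal_prod_of_nonneg fun i _ => hg _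
  simp only [e]
  rw [h, Finset.prod_congr rfl fun i _ => hX.lintegral_ofReal_comp hα i hg hs,
    Finset.prod_const, ← ENNReal.ofReal_pow]
  exact tsum_nonneg fun k => mul_nonneg (weight_pos hα k).le (hg k)

lemma IsIIDStretchedExp.measurable_partialSum (hX : IsIIDStretchedExp P α X) (n : ℕ) :
    Measurable (partialSum X n) :=
  Finset.measurable_sum _ fun i _ => hX.measurable i

lemma IsIIDStretchedExp.measurable_partialMax (hX : IsIIDStretchedExp P α X) (n : ℕ) :
    Measurable (partialMax X n) := by
  have h : ∀ B : Finset ℕ, Measurable fun ω => B.sup fun i => X i ω := by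
    intro B
    induction B using Finset.cons_induction with
    | empty => simp
    | cons i B hi ih =>
      simp only [Finset.sup_cons]
      exact (hX.measurable i).sup ih
  exact h _

end Law

/-! ### Upper bound: exponential Chebyshev with finitely many slopes -/

section UpperBound

/-- Finitely many slopes suffice for the Legendre transform of a quadratic function, up to `δ`
and up to the level `J`. -/
lemma exists_finset_slopes {v δ : ℝ} (hv : 0 < v) (hδ : 0 < δ) (J : ℝ) :
    ∃ G : Finset ℝ, ∀ t : ℝ, ∃ a ∈ G,
      1 / (2 * v) * t ^ 2 - δ ≤ a * t - a ^ 2 * v / 2 ∨ J ≤ a * t - a ^ 2 * v / 2 := by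
  -- Chosen so that `T² / (2v) = |J|`: the slopes `± T / v` already reach the level `J` outside
  -- `[-T, T]`. Inside, compactness selects finitely many of the optimal slopes `t / v`.
  set T := √(2 * v * |J|) with hT
  have hT0 : 0 ≤ T := Real.sqrt_nonneg _
  have hT2 : T ^ 2 = 2 * v * |J| := Real.sq_sqrt (by positivity)
  obtain ⟨G, hG⟩ := isCompact_Icc.elim_finite_subcover (s := Set.Icc (-T) T)
    (fun a : ℝ => {t : ℝ | 1 / (2 * v) * t ^ 2 - δ < a * t - a ^ 2 * v / 2})
    (fun a => isOpen_lt (by fun_prop) (by fun_prop)) (fun t _ => by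
      refine Set.mem_iUnion.2 ⟨t / v, ?_⟩
      change 1 / (2 * v) * t ^ 2 - δ < t / v * t - (t / v) ^ 2 * v / 2
      have : t / v * t - (t / v) ^ 2 * v / 2 = 1 / (2 * v) * t ^ 2 := by field_simp; ring
      linarith)
  classical
  refine ⟨insert (T / v) (insert (-T / v) G), fun t => ?_⟩
  have key : ∀ u, T ≤ u → J ≤ T / v * u - (T / v) ^ 2 * v / 2 := by
    intro u hu
    have h1 : T / v * T ≤ T / v * u := mul_le_mul_of_nonneg_left hu (by positivity)
    have h2 : T / v * T - (T / v) ^ 2 * v / 2 = |J| := by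
      have : T / v * T - (T / v) ^ 2 * v / 2 = T ^ 2 / (2 * v) := by field_simp; ring
      rw [this, hT2]; field_simp
    linarith [le_abs_self J]
  by_cases h1 : T ≤ t
  · exact ⟨T / v, by simp, Or.inr (key t h1)⟩
  by_cases h2 : t ≤ -T
  · refine ⟨-T / v, by simp, Or.inr ?_⟩
    have := key (-t) (by linarith)
    rw [neg_div]
    nlinarith
  · obtain ⟨a, ha, hat⟩ := Set.mem_iUnion₂.1 (hG ⟨by linarith, by linarith⟩ : t ∈ _)
    exact ⟨a, by simp [ha], Or.inl (le_of_lt hat)⟩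

/-- The small entries contribute only through their sum, which is the prescribed total minus the
large entries. The exponent is thus a function of the large entries alone. -/
lemma prod_tilt_eq_exp {α γ : ℝ} (hα₁ : α < 1) (hγ : γ = 1 / (2 - α)) (m ε η a r : ℝ) {n : ℕ}
    (hn : 1 ≤ n) (ξ : ℕ → ℕ)
    (hS : ∑ i ∈ Finset.range n, (ξ i : ℝ) = m * n + r * (n : ℝ) ^ γ) :
    ∏ i ∈ Finset.range n, tilt α m γ ε η 1 a n (ξ i) =
      Real.exp ((n : ℝ) ^ (γ * α) *
        (a * (r - ∑ i ∈ Finset.range n with ¬ (ξ i : ℝ) ≤ ε * (n : ℝ) ^ γ,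
            (ξ i : ℝ) / (n : ℝ) ^ γ) +
          (1 - η) * ∑ i ∈ Finset.range n with ¬ (ξ i : ℝ) ≤ ε * (n : ℝ) ^ γ,
            ((ξ i : ℝ) / (n : ℝ) ^ γ) ^ α)) := by
  have hn' : (0 : ℝ) < n := by exact_mod_cast hn
  have hp : 0 < (n : ℝ) ^ γ := by positivity
  have e1 : (n : ℝ) ^ (γ - 1) * (n : ℝ) ^ γ = (n : ℝ) ^ (γ * α) := by
    rw [← Real.rpow_add hn', gamma_mul_alpha hα₁ hγ]; congr 1; ring
  set L := a * (n : ℝ) ^ (γ - 1) with hL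
  have e2 : ∀ k : ℕ, tilt α m γ ε η 1 a n k = Real.exp (L * k - L * m +
      if ¬ (k : ℝ) ≤ ε * (n : ℝ) ^ γ then (1 - η) * (k : ℝ) ^ α - L * k else 0) := by
    intro k
    unfold tilt
    by_cases hk : (k : ℝ) ≤ ε * (n : ℝ) ^ γ
    · rw [if_pos hk, if_neg (not_not.2 hk)]; congr 1; ring
    · rw [if_neg hk, if_pos hk, one_mul]; congr 1; ring
  simp only [e2]
  rw [← Real.exp_sum, Finset.sum_add_distrib, Finset.sum_sub_distrib, ← Finset.mul_sum, hS,
    Finset.sum_const, Finset.card_range, nsmul_eq_mul, ← Finset.sum_filter,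
    Finset.sum_sub_distrib, ← Finset.mul_sum, ← Finset.mul_sum]
  have e3 : ∀ k : ℕ, ((k : ℝ) / (n : ℝ) ^ γ) ^ α = (k : ℝ) ^ α / (n : ℝ) ^ (γ * α) := by
    intro k
    rw [Real.div_rpow (by positivity) (by positivity), ← Real.rpow_mul hn'.le]
  simp only [e3]
  rw [← Finset.sum_div, ← Finset.sum_div]
  congr 1
  set U := ∑ i ∈ Finset.range n with ¬ (ξ i : ℝ) ≤ ε * (n : ℝ) ^ γ, (ξ i : ℝ)
  set W := ∑ i ∈ Finset.range n with ¬ (ξ i : ℝ) ≤ ε * (n : ℝ) ^ γ, (ξ i : ℝ) ^ α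
  have hp2 : (n : ℝ) ^ (γ * α) ≠ 0 := by positivity
  have e4 : (n : ℝ) ^ (γ * α) * (a * (r - U / (n : ℝ) ^ γ) + (1 - η) * (W / (n : ℝ) ^ (γ * α))) =
      a * ((n : ℝ) ^ (γ * α) / (n : ℝ) ^ γ) * (r * (n : ℝ) ^ γ - U) + (1 - η) * W := by
    field_simp
  have e5 : (n : ℝ) ^ (γ * α) / (n : ℝ) ^ γ = (n : ℝ) ^ (γ - 1) := by
    rw [← e1]; field_simp
  rw [e4, e5, ← hL]
  ring

/-- The entries above the truncation level form a competitor for `f` at the maximum. -/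
lemma le_finCost_of_max_mem {α σ2 s γ ε J : ℝ} (hα₀ : 0 < α)
    {A : Set ℝ≥0} (hA : ∀ y ∈ A, (J : EReal) ≤ f α σ2 s y)
    (hε : 0 ∉ A → ∀ y ∈ A, ε < (y : ℝ)) {n : ℕ} (hn : 1 ≤ n) (ξ : ℕ → ℕ)
    (hmax : (((Finset.range n).sup ξ : ℕ) : ℝ≥0) / (n : ℝ≥0) ^ γ ∈ A) :
    J ≤ finCost α σ2 s {i ∈ Finset.range n | ¬ (ξ i : ℝ) ≤ ε * (n : ℝ) ^ γ}
      fun i => (ξ i : ℝ≥0) / (n : ℝ≥0) ^ γ := by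
  have hn' : (0 : ℝ) < n := by exact_mod_cast hn
  have hp : 0 < (n : ℝ) ^ γ := by positivity
  set B := {i ∈ Finset.range n | ¬ (ξ i : ℝ) ≤ ε * (n : ℝ) ^ γ} with hB
  suffices h : B.sup (fun i => (ξ i : ℝ≥0) / (n : ℝ≥0) ^ γ) ∈ A by
    have h1 := (hA _ h).trans (f_sup_le_finCost hα₀ σ2 s B _)
    exact_mod_cast h1
  obtain ⟨i₀, hi₀, hi₀'⟩ := Finset.exists_mem_eq_sup (Finset.range n)
    (Finset.nonempty_range_iff.2 (by omega)) ξ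
  have hle : ∀ i ∈ Finset.range n, ξ i ≤ ξ i₀ := fun i hi => hi₀' ▸ Finset.le_sup hi
  rw [hi₀'] at hmax
  by_cases hbig : (ξ i₀ : ℝ) ≤ ε * (n : ℝ) ^ γ
  -- Without large entries the supremum is that of the empty family, namely `0`. If `0 ∉ A`, then
  -- `ε` lies below all of `A`, and the maximum could not be in `A`.
  · have hBe : B = ∅ := by
      rw [hB, Finset.filter_eq_empty_iff]
      intro i hi
      rw [not_not]
      exact le_trans (by exact_mod_cast hle i hi) hbig
    rw [hBe, Finset.sup_empty]
    by_contra h0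
    have h1 := hε h0 _ hmax
    push_cast at h1
    rw [lt_div_iff₀ hp] at h1
    linarith
  · have hmem : i₀ ∈ B := by rw [hB, Finset.mem_filter]; exact ⟨hi₀, hbig⟩
    convert hmax using 1
    apply le_antisymm
    · refine Finset.sup_le fun i hi => ?_
      have := hle i (Finset.mem_filter.1 hi).1
      gcongr
    · exact Finset.le_sup (f := fun i => (ξ i : ℝ≥0) / (n : ℝ≥0) ^ γ) hmem

variable {Ω : Type*} [MeasurableSpace Ω] {P : Measure Ω} {X : ℕ → Ω → ℕ}

lemma eventually_truncation {α : ℝ} (hα₁ : α < 1) (a : ℝ) :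
    ∀ᶠ ε in 𝓝[>] (0 : ℝ), |a| * ε ^ (1 - α) ≤ 1 / 2 := by
  have h : Tendsto (fun ε : ℝ => |a| * ε ^ (1 - α)) (𝓝[>] 0) (𝓝 0) := by
    have h1 : ContinuousAt (fun ε : ℝ => |a| * ε ^ (1 - α)) 0 :=
      continuousAt_const.mul (Real.continuousAt_rpow_const _ _ (Or.inr (by linarith)))
    have h2 := h1.tendsto
    rw [Real.zero_rpow (by linarith), mul_zero] at h2
    exact h2.mono_left nhdsWithin_le_nhds
  exact h.eventually_le_const (by norm_num)

/-- On the event the large entries cost at least `J`, so for a suitable slope in a finite set the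
product of weights exceeds its mean by a factor of nearly `exp (n^(γα) J)`. Markov's inequality and
a union over the slopes conclude. The error `δ` is spent as `δ/4` each on `η`, on the choice of
slope and on `s_n → s`, and `δ/8` each on the mean and on the number of slopes. -/
lemma eventually_joint_le_aux {α γ m v s J δ : ℝ} (hα₀ : 0 < α) (hα₁ : α < 1)
    (hγ : γ = 1 / (2 - α)) (hX : IsIIDStretchedExp P α X)
    (hm : ∑' k : ℕ, weight α k * (k : ℝ) = m)
    (hv : ∑' k : ℕ, weight α k * ((k : ℝ) - m) ^ 2 = v)
    {sn : ℕ → ℝ} (hs : Tendsto sn atTop (𝓝 s)) {A : Set ℝ≥0} (hAc : IsClosed A)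
    (hA : ∀ y ∈ A, (J : EReal) ≤ f α v s y) (hJ : 0 ≤ J) (hδ : 0 < δ) :
    ∀ᶠ n : ℕ in atTop, P {ω | (partialSum X n ω : ℝ) = m * n + sn n * (n : ℝ) ^ γ ∧
      (partialMax X n ω : ℝ≥0) / (n : ℝ≥0) ^ γ ∈ A} ≤
        ENNReal.ofReal (Real.exp (-(n : ℝ) ^ (γ * α) * (J - δ))) := by
  have hv0 : 0 < v := hv ▸ tsum_weight_mul_sq_sub_pos hα₀ m
  have hm0 : 0 ≤ m := hm ▸ tsum_nonneg fun k => mul_nonneg (weight_pos hα₀ k).le (by positivity)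
  obtain ⟨η, hη, hη', hηJ⟩ : ∃ η : ℝ, 0 < η ∧ η ≤ 1 / 2 ∧ η * J ≤ δ / 4 := by
    refine ⟨min (1 / 2) (δ / (4 * (J + 1))), by positivity, min_le_left _ _, ?_⟩
    calc min (1 / 2) (δ / (4 * (J + 1))) * J ≤ δ / (4 * (J + 1)) * (J + 1) :=
          mul_le_mul (min_le_right _ _) (by linarith) hJ (by positivity)
      _ = δ / 4 := by field_simp
  obtain ⟨G, hG⟩ := exists_finset_slopes hv0 (by linarith : 0 < δ / 4) J
  obtain ⟨ε, hε, hεA, hεG⟩ : ∃ ε : ℝ, 0 < ε ∧ (0 ∉ A → ∀ y ∈ A, ε < (y : ℝ)) ∧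
      ∀ a ∈ G, |a| * ε ^ (1 - α) ≤ 1 / 2 := by
    have h1 : ∀ᶠ ε in 𝓝[>] (0 : ℝ), ∀ a ∈ G, |a| * ε ^ (1 - α) ≤ 1 / 2 :=
      (Finset.eventually_all G).2 fun a _ => eventually_truncation hα₁ a
    have h2 : ∀ᶠ ε in 𝓝[>] (0 : ℝ), 0 ∉ A → ∀ y ∈ A, ε < (y : ℝ) := by
      by_cases h0 : 0 ∈ A
      · exact Eventually.of_forall fun ε h => absurd h0 h
      · obtain ⟨ρ, hρ, hball⟩ := Metric.isOpen_iff.1 hAc.isOpen_compl 0 h0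
        filter_upwards [nhdsWithin_le_nhds (eventually_lt_nhds hρ)] with ε hερ _ y hy
        refine hερ.trans_le (not_lt.1 fun hlt => hball ?_ hy)
        rw [Metric.mem_ball, NNReal.dist_eq]
        simpa using hlt
    obtain ⟨ε, ⟨h1, h2⟩, h3⟩ := ((h1.and h2).and self_mem_nhdsWithin).exists
    exact ⟨ε, h3, h2, h1⟩
  have hN : Tendsto (fun n : ℕ => ((fun n => n) n : ℝ) / n) atTop (𝓝 1) := by
    refine tendsto_const_nhds.congr' ?_
    filter_upwards [eventually_ge_atTop 1] with n hn
    have : (n : ℝ) ≠ 0 := by positivity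
    simp [this]
  have hev1 : ∀ᶠ n : ℕ in atTop, ∀ a ∈ G, tiltMean α m γ ε η 1 a n ^ n ≤
      Real.exp ((n : ℝ) ^ (γ * α) * (a ^ 2 * v / 2 + δ / 8)) :=
    (Finset.eventually_all G).2 fun a ha =>
      (eventually_tiltMean_pow_bounds hα₀ hα₁ hγ hm hv hε hη hη' zero_le_one le_rfl (hεG a ha)
        hN (by linarith : 0 < δ / 8)).mono fun n h => h.2
  have hev2 : ∀ᶠ n : ℕ in atTop, ∀ a ∈ G, -(δ / 4) ≤ a * (sn n - s) := by
    refine (Finset.eventually_all G).2 fun a _ => ?_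
    have h : Tendsto (fun n => a * (sn n - s)) atTop (𝓝 0) := by
      simpa using (hs.sub_const s).const_mul a
    exact h.eventually_const_le (by linarith)
  have hev3 : ∀ᶠ n : ℕ in atTop, (G.card : ℝ) ≤ Real.exp ((n : ℝ) ^ (γ * α) * (δ / 8)) :=
    (Real.tendsto_exp_atTop.comp ((tendsto_natCast_rpow_gamma_mul_alpha hα₀ hα₁ hγ).atTop_mul_const
      (by linarith : 0 < δ / 8))).eventually_ge_atTop _
  filter_upwards [hev1, hev2, hev3, eventually_ge_atTop 1] with n h1 h2 h3 hn
  have hn' : (0 : ℝ) < n := by exact_mod_cast hn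
  set q := (n : ℝ) ^ (γ * α) with hq
  have hq0 : 0 < q := by positivity
  have hsub : {ω | (partialSum X n ω : ℝ) = m * n + sn n * (n : ℝ) ^ γ ∧
      (partialMax X n ω : ℝ≥0) / (n : ℝ≥0) ^ γ ∈ A} ⊆
      ⋃ a ∈ G, {ω | ENNReal.ofReal (Real.exp (q * (a ^ 2 * v / 2 + J - 3 * δ / 4))) ≤
        ENNReal.ofReal (∏ i ∈ Finset.range n, tilt α m γ ε η 1 a n (X i ω))} := by
    rintro ω ⟨hS, hM⟩
    have hcost := le_finCost_of_max_mem (ε := ε) hα₀ hA hεA hn (fun i => X i ω) hM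
    unfold finCost at hcost
    push_cast at hcost
    set U := ∑ i ∈ Finset.range n with ¬ (X i ω : ℝ) ≤ ε * (n : ℝ) ^ γ, (X i ω : ℝ) / (n : ℝ) ^ γ
      with hU
    set W := ∑ i ∈ Finset.range n with ¬ (X i ω : ℝ) ≤ ε * (n : ℝ) ^ γ,
      ((X i ω : ℝ) / (n : ℝ) ^ γ) ^ α with hW
    have hW0 : 0 ≤ W := Finset.sum_nonneg fun i _ => by positivity
    obtain ⟨a, ha, hat⟩ := hG (s - U)
    refine Set.mem_iUnion₂.2 ⟨a, ha, ENNReal.ofReal_le_ofReal ?_⟩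
    have hS' : ∑ i ∈ Finset.range n, (X i ω : ℝ) = m * n + sn n * (n : ℝ) ^ γ := by
      rw [← hS, partialSum]; push_cast; rfl
    rw [prod_tilt_eq_exp hα₁ hγ m ε η a (sn n) hn (fun i => X i ω) hS', ← hU, ← hW]
    refine Real.exp_le_exp.2 (mul_le_mul_of_nonneg_left ?_ hq0.le)
    have h2a := h2 a ha
    have e : a * (sn n - U) = a * (s - U) + a * (sn n - s) := by ring
    -- If the slope is nearly optimal for `s - U`, the jump and quadratic costs add up to at least
    -- `J` up to errors; otherwise the linear term reaches `J` alone.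
    rw [e]
    have hηW : 0 ≤ (1 - η) * W := mul_nonneg (by linarith) hW0
    rcases hat with hat | hat
    · have ht0 : 0 ≤ 1 / (2 * v) * (s - U) ^ 2 := by positivity
      have h5 : J - δ / 4 ≤ (1 - η) * W + 1 / (2 * v) * (s - U) ^ 2 := by
        have h6 := mul_le_mul_of_nonneg_left hcost (by linarith : 0 ≤ 1 - η)
        nlinarith
      linarith
    · linarith
  refine (measure_mono hsub).trans ((measure_biUnion_finset_le G _).trans ?_)
  have hterm : ∀ a ∈ G, P {ω | ENNReal.ofReal (Real.exp (q * (a ^ 2 * v / 2 + J - 3 * δ / 4))) ≤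
        ENNReal.ofReal (∏ i ∈ Finset.range n, tilt α m γ ε η 1 a n (X i ω))} ≤
        ENNReal.ofReal (Real.exp (-q * (J - 7 * δ / 8))) := by
    intro a ha
    have hmeas : Measurable fun ω =>
        ENNReal.ofReal (∏ i ∈ Finset.range n, tilt α m γ ε η 1 a n (X i ω)) := by
      refine ENNReal.measurable_ofReal.comp (Finset.measurable_prod _ fun i _ => ?_)
      exact (measurable_of_countable (tilt α m γ ε η 1 a n)).comp (hX.measurable i)
    have hpos : 0 < Real.exp (q * (a ^ 2 * v / 2 + J - 3 * δ / 4)) := Real.exp_pos _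
    refine (meas_ge_le_lintegral_div hmeas.aemeasurable (by simpa using hpos)
      ENNReal.ofReal_ne_top).trans ?_
    rw [hX.lintegral_prod hα₀ _ (fun k => tilt_nonneg zero_le_one n k)
      (summable_weight_mul_tilt hα₀ hα₁ hγ hm0 hε hη hη' zero_le_one le_rfl (hεG a ha) hn),
      Finset.card_range, ← ENNReal.ofReal_div_of_pos hpos]
    refine ENNReal.ofReal_le_ofReal ?_
    rw [div_le_iff₀ hpos, ← Real.exp_add]
    refine (h1 a ha).trans (Real.exp_le_exp.2 (le_of_eq ?_))
    ring
  refine (Finset.sum_le_sum hterm).trans ?_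
  rw [Finset.sum_const, nsmul_eq_mul, ← ENNReal.ofReal_natCast,
    ← ENNReal.ofReal_mul (Nat.cast_nonneg _)]
  refine ENNReal.ofReal_le_ofReal ?_
  calc (G.card : ℝ) * Real.exp (-q * (J - 7 * δ / 8))
      ≤ Real.exp (q * (δ / 8)) * Real.exp (-q * (J - 7 * δ / 8)) := by gcongr
    _ = Real.exp (-q * (J - δ)) := by rw [← Real.exp_add]; congr 1; ring

/-- Upper bound for the joint probabilities. -/
lemma eventually_joint_le {α γ m v s J J' : ℝ} (hα₀ : 0 < α) (hα₁ : α < 1)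
    (hγ : γ = 1 / (2 - α)) (hX : IsIIDStretchedExp P α X)
    (hm : ∑' k : ℕ, weight α k * (k : ℝ) = m)
    (hv : ∑' k : ℕ, weight α k * ((k : ℝ) - m) ^ 2 = v)
    {sn : ℕ → ℝ} (hs : Tendsto sn atTop (𝓝 s)) {A : Set ℝ≥0} (hAc : IsClosed A)
    (hA : ∀ y ∈ A, (J : EReal) ≤ f α v s y) (hJ : J' < J) :
    ∀ᶠ n : ℕ in atTop, P {ω | (partialSum X n ω : ℝ) = m * n + sn n * (n : ℝ) ^ γ ∧
      (partialMax X n ω : ℝ≥0) / (n : ℝ≥0) ^ γ ∈ A} ≤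
        ENNReal.ofReal (Real.exp (-(n : ℝ) ^ (γ * α) * J')) := by
  have hv0 : 0 < v := hv ▸ tsum_weight_mul_sq_sub_pos hα₀ m
  -- As `f ≥ 0`, a negative level may be raised to `0`.
  have hA' : ∀ y ∈ A, ((max J 0 : ℝ) : EReal) ≤ f α v s y := by
    intro y hy
    rcases le_total J 0 with h | h
    · rw [max_eq_right h]; exact f_nonneg hv0 s y
    · rw [max_eq_left h]; exact hA y hy
  have hlt : J' < max J 0 := hJ.trans_le (le_max_left _ _)
  have h := eventually_joint_le_aux hα₀ hα₁ hγ hX hm hv hs hAc hA' (le_max_right _ _)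
    (sub_pos.2 hlt)
  simpa using h

end UpperBound

/-! ### Lower bound for the bulk, and prescribing the remaining variables -/

section Bulk

variable {Ω : Type*} {X : ℕ → Ω → ℕ}

lemma prod_tilt_of_le {α m γ ε η b a : ℝ} {n N : ℕ} (ξ : ℕ → ℕ)
    (h : ∀ i ∈ Finset.range N, (ξ i : ℝ) ≤ ε * (n : ℝ) ^ γ) :
    ∏ i ∈ Finset.range N, tilt α m γ ε η b a n (ξ i) =
      Real.exp (a * (n : ℝ) ^ (γ - 1) * (∑ i ∈ Finset.range N, (ξ i : ℝ) - m * N)) := by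
  rw [Finset.prod_congr rfl fun i hi => by rw [tilt, if_pos (h i hi)], ← Real.exp_sum,
    ← Finset.mul_sum, Finset.sum_sub_distrib, Finset.sum_const, Finset.card_range, nsmul_eq_mul]
  congr 2
  ring

/-- The event that the sum of the first `N` variables lies in a window around `m N + t n^γ` and
that none of them exceeds `ε n^γ`. -/
def bulkEvent (X : ℕ → Ω → ℕ) (m γ t κ ε : ℝ) (n N : ℕ) : Set Ω :=
  {ω | |(partialSum X N ω : ℝ) - m * N - t * (n : ℝ) ^ γ| ≤ κ * (n : ℝ) ^ γ ∧
    ∀ i ∈ Finset.range N, (X i ω : ℝ) ≤ ε * (n : ℝ) ^ γ}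

/-- The set of vectors that defines `bulkEvent`. -/
def bulkSet (m γ t κ ε : ℝ) (n N : ℕ) : Set (Finset.range N → ℕ) :=
  {ξ | |((∑ i, ξ i : ℕ) : ℝ) - m * N - t * (n : ℝ) ^ γ| ≤ κ * (n : ℝ) ^ γ ∧
    ∀ i, (ξ i : ℝ) ≤ ε * (n : ℝ) ^ γ}

lemma partialSum_eq_sum_coe (N : ℕ) (ω : Ω) :
    partialSum X N ω = ∑ i : Finset.range N, X i ω :=
  (Finset.sum_coe_sort (Finset.range N) fun i => X i ω).symm

lemma bulkEvent_eq_preimage (m γ t κ ε : ℝ) (n N : ℕ) :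
    bulkEvent X m γ t κ ε n N =
      (fun ω (i : Finset.range N) => X i ω) ⁻¹' bulkSet m γ t κ ε n N := by
  ext ω
  simp only [bulkEvent, bulkSet, Set.mem_ofPred_eq, Set.mem_preimage, partialSum_eq_sum_coe,
    Subtype.forall]

/-- Pointwise comparison behind the tilting bound: outside of the window the tilted weight is
controlled by weights with a larger or a smaller slope. -/
lemma prod_tilt_le_indicator_add {α γ : ℝ} (hα₁ : α < 1) (hγ : γ = 1 / (2 - α))
    (m t κ ε η a : ℝ) {θ : ℝ} (hθ : 0 ≤ θ) {n N : ℕ} (hn : 1 ≤ n) (ω : Ω) :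
    ENNReal.ofReal (∏ i ∈ Finset.range N, tilt α m γ ε η 0 a n (X i ω)) ≤
      (bulkEvent X m γ t κ ε n N).indicator
        (fun _ => ENNReal.ofReal (Real.exp ((n : ℝ) ^ (γ * α) * (a * t + |a| * κ)))) ω +
      (ENNReal.ofReal (Real.exp (-(n : ℝ) ^ (γ * α) * (θ * (t + κ)))) *
        ENNReal.ofReal (∏ i ∈ Finset.range N, tilt α m γ ε η 0 (a + θ) n (X i ω)) +
      ENNReal.ofReal (Real.exp ((n : ℝ) ^ (γ * α) * (θ * (t - κ)))) *
        ENNReal.ofReal (∏ i ∈ Finset.range N, tilt α m γ ε η 0 (a - θ) n (X i ω))) := by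
  have hn' : (0 : ℝ) < n := by exact_mod_cast hn
  by_cases hle : ∀ i ∈ Finset.range N, (X i ω : ℝ) ≤ ε * (n : ℝ) ^ γ
  · rw [prod_tilt_of_le _ hle, prod_tilt_of_le _ hle, prod_tilt_of_le _ hle]
    have hS : ∑ i ∈ Finset.range N, (X i ω : ℝ) = partialSum X N ω := by
      rw [partialSum]; push_cast; rfl
    rw [hS]
    set V := (partialSum X N ω : ℝ) - m * N with hV
    set R := (n : ℝ) ^ (γ - 1) with hR
    set p := (n : ℝ) ^ γ with hp
    have hR0 : 0 < R := by positivity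
    have hq : (n : ℝ) ^ (γ * α) = R * p := by
      rw [hR, hp, ← Real.rpow_add hn', gamma_mul_alpha hα₁ hγ]; congr 1; ring
    rw [hq, ← ENNReal.ofReal_mul (Real.exp_pos _).le, ← ENNReal.ofReal_mul (Real.exp_pos _).le,
      ← Real.exp_add, ← Real.exp_add]
    by_cases hW : |V - t * p| ≤ κ * p
    · rw [Set.indicator_of_mem (show ω ∈ bulkEvent X m γ t κ ε n N from ⟨hW, hle⟩)]
      refine le_add_of_le_of_nonneg (ENNReal.ofReal_le_ofReal (Real.exp_le_exp.2 ?_)) zero_le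
      have h1 : a * (V - t * p) ≤ |a| * (κ * p) := by
        refine (le_abs_self _).trans ?_
        rw [abs_mul]
        gcongr
      have h2 := mul_le_mul_of_nonneg_left h1 hR0.le
      linarith
    · refine le_add_of_nonneg_of_le zero_le ?_
      -- Above the window the slope `a + θ` dominates, below it `a - θ`; the exponential prefactors
      -- are exactly what is gained at the edges of the window.
      rcases lt_abs.1 (not_le.1 hW) with h | h
      · refine le_add_of_le_of_nonneg (ENNReal.ofReal_le_ofReal (Real.exp_le_exp.2 ?_)) zero_le
        have h2 := mul_le_mul_of_nonneg_left h.le (mul_nonneg hR0.le hθ)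
        linarith
      · refine le_add_of_nonneg_of_le zero_le (ENNReal.ofReal_le_ofReal (Real.exp_le_exp.2 ?_))
        have h2 := mul_le_mul_of_nonneg_left h.le (mul_nonneg hR0.le hθ)
        linarith
  · push Not at hle
    obtain ⟨i, hi, hlt⟩ := hle
    -- With `b = 0` a single entry above the truncation level annihilates the product.
    rw [Finset.prod_eq_zero hi (by rw [tilt, if_neg (not_le.2 hlt), zero_mul])]
    simp

variable [MeasurableSpace Ω] {P : Measure Ω}

lemma IsIIDStretchedExp.measurable_restrict {α : ℝ} (hX : IsIIDStretchedExp P α X)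
    (B : Finset ℕ) : Measurable fun ω (i : B) => X i ω :=
  measurable_pi_lambda _ fun i => hX.measurable i

lemma IsIIDStretchedExp.measurableSet_bulkEvent {α : ℝ} (hX : IsIIDStretchedExp P α X)
    (m γ t κ ε : ℝ) (n N : ℕ) : MeasurableSet (bulkEvent X m γ t κ ε n N) := by
  rw [bulkEvent_eq_preimage]
  exact hX.measurable_restrict _ (Set.to_countable _).measurableSet

/-- The moderate deviation lower bound for the bulk. -/
lemma eventually_le_bulkEvent {α γ m v t κ ε₀ δ : ℝ} (hα₀ : 0 < α) (hα₁ : α < 1)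
    (hγ : γ = 1 / (2 - α)) [IsProbabilityMeasure P] (hX : IsIIDStretchedExp P α X)
    (hm : ∑' k : ℕ, weight α k * (k : ℝ) = m)
    (hv : ∑' k : ℕ, weight α k * ((k : ℝ) - m) ^ 2 = v)
    {N : ℕ → ℕ} (hN : Tendsto (fun n => (N n : ℝ) / n) atTop (𝓝 1))
    (hκ : 0 < κ) (hε₀ : 0 < ε₀) (hδ : 0 < δ) :
    ∀ᶠ n : ℕ in atTop,
      Real.exp (-(n : ℝ) ^ (γ * α) * (1 / (2 * v) * t ^ 2 + |t| / v * κ + δ)) ≤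
        P.real (bulkEvent X m γ t κ ε₀ n (N n)) := by
  have hv0 : 0 < v := hv ▸ tsum_weight_mul_sq_sub_pos hα₀ m
  have hm0 : 0 ≤ m := hm ▸ tsum_nonneg fun k => mul_nonneg (weight_pos hα₀ k).le (by positivity)
  -- `a` is the optimal slope for the shift `t`. The terms outside the window have exponent `a² v /
  -- 2 - θκ + θ² v / 2`, which is smallest at `θ = κ / v`, with a gain of `κ² / (2v)`.
  set a := t / v with ha
  set θ := κ / v with hθ
  have hθ0 : 0 < θ := by positivity
  obtain ⟨ε, hε, hεε₀, ha1, ha2, ha3⟩ : ∃ ε : ℝ, 0 < ε ∧ ε ≤ ε₀ ∧ |a| * ε ^ (1 - α) ≤ 1 / 2 ∧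
      |a + θ| * ε ^ (1 - α) ≤ 1 / 2 ∧ |a - θ| * ε ^ (1 - α) ≤ 1 / 2 := by
    have h0 : ∀ᶠ ε in 𝓝[>] (0 : ℝ), 0 < ε := self_mem_nhdsWithin
    have h0' : ∀ᶠ ε in 𝓝[>] (0 : ℝ), ε ≤ ε₀ := nhdsWithin_le_nhds (eventually_le_nhds hε₀)
    obtain ⟨ε, h1, h2, h3, h4, h5⟩ := (h0.and (h0'.and
      ((eventually_truncation hα₁ a).and ((eventually_truncation hα₁ (a + θ)).and
      (eventually_truncation hα₁ (a - θ)))))).exists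
    exact ⟨ε, h1, h2, h3, h4, h5⟩
  -- With `4 δ' ≤ κ² / (2v)` the two outer terms stay below `exp (q (a² v / 2 - 3δ'))`, while the
  -- whole tilted mass is at least `exp (q (a² v / 2 - δ'))`, where `q = n^(γα)`.
  set δ' := min (δ / 2) (κ ^ 2 / (8 * v)) with hδ'
  have hδ'0 : 0 < δ' := by positivity
  have hδ'1 : 2 * δ' ≤ δ := by linarith [min_le_left (δ / 2) (κ ^ 2 / (8 * v))]
  have hδ'2 : 4 * δ' ≤ κ ^ 2 / (2 * v) := by
    have h1 : δ' ≤ κ ^ 2 / (8 * v) := min_le_right _ _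
    have h2 : κ ^ 2 / (2 * v) = 4 * (κ ^ 2 / (8 * v)) := by field_simp; norm_num
    linarith
  have hη : (0 : ℝ) < 1 / 2 := by norm_num
  have hev4 : ∀ᶠ n : ℕ in atTop, (2 : ℝ) ≤ Real.exp ((n : ℝ) ^ (γ * α) * δ') :=
    (Real.tendsto_exp_atTop.comp ((tendsto_natCast_rpow_gamma_mul_alpha hα₀ hα₁ hγ).atTop_mul_const
      hδ'0)).eventually_ge_atTop _
  filter_upwards [eventually_tiltMean_pow_bounds hα₀ hα₁ hγ hm hv hε hη le_rfl le_rfl zero_le_one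
      ha1 hN hδ'0,
    eventually_tiltMean_pow_bounds hα₀ hα₁ hγ hm hv hε hη le_rfl le_rfl zero_le_one ha2 hN hδ'0,
    eventually_tiltMean_pow_bounds hα₀ hα₁ hγ hm hv hε hη le_rfl le_rfl zero_le_one ha3 hN hδ'0,
    hev4, eventually_ge_atTop 1] with n h1 h2 h3 h4 hn
  have hmono : P.real (bulkEvent X m γ t κ ε n (N n)) ≤ P.real (bulkEvent X m γ t κ ε₀ n (N n)) := by
    refine measureReal_mono fun ω hω => ⟨hω.1, fun i hi => (hω.2 i hi).trans ?_⟩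
    gcongr
  refine le_trans ?_ hmono
  have hmeasT : ∀ a' : ℝ, Measurable fun ω =>
      ENNReal.ofReal (∏ i ∈ Finset.range (N n), tilt α m γ ε (1 / 2) 0 a' n (X i ω)) := fun a' => by
    refine ENNReal.measurable_ofReal.comp (Finset.measurable_prod _ fun i _ => ?_)
    exact (measurable_of_countable (tilt α m γ ε (1 / 2) 0 a' n)).comp (hX.measurable i)
  have hint := lintegral_mono (μ := P) fun ω => prod_tilt_le_indicator_add (X := X) hα₁ hγ m t κ ε
    (1 / 2) a hθ0.le (N := N n) hn ω
  have hbulk := hX.measurableSet_bulkEvent m γ t κ ε n (N n)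
  rw [lintegral_add_left (measurable_const.indicator hbulk),
    lintegral_add_left ((hmeasT (a + θ)).const_mul _), lintegral_const_mul _ (hmeasT _),
    lintegral_const_mul _ (hmeasT _), lintegral_indicator_const hbulk,
    hX.lintegral_prod hα₀ _ (fun k => tilt_nonneg le_rfl n k)
      (summable_weight_mul_tilt hα₀ hα₁ hγ hm0 hε hη le_rfl le_rfl zero_le_one ha1 hn),
    hX.lintegral_prod hα₀ _ (fun k => tilt_nonneg le_rfl n k)
      (summable_weight_mul_tilt hα₀ hα₁ hγ hm0 hε hη le_rfl le_rfl zero_le_one ha2 hn),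
    hX.lintegral_prod hα₀ _ (fun k => tilt_nonneg le_rfl n k)
      (summable_weight_mul_tilt hα₀ hα₁ hγ hm0 hε hη le_rfl le_rfl zero_le_one ha3 hn),
    Finset.card_range] at hint
  change ENNReal.ofReal (tiltMean α m γ ε (1 / 2) 0 a n ^ N n) ≤ _ *
    P (bulkEvent X m γ t κ ε n (N n)) + (_ * ENNReal.ofReal
      (tiltMean α m γ ε (1 / 2) 0 (a + θ) n ^ N n) + _ * ENNReal.ofReal
      (tiltMean α m γ ε (1 / 2) 0 (a - θ) n ^ N n)) at hint
  set q := (n : ℝ) ^ (γ * α) with hq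
  have hM0 : ∀ a', 0 ≤ tiltMean α m γ ε (1 / 2) 0 a' n := fun a' =>
    tsum_nonneg fun k => mul_nonneg (weight_pos hα₀ k).le (tilt_nonneg le_rfl n k)
  have hM0' : ∀ a', 0 ≤ tiltMean α m γ ε (1 / 2) 0 a' n ^ N n := fun a' => pow_nonneg (hM0 a') _
  rw [← ofReal_measureReal, ← ENNReal.ofReal_mul (Real.exp_pos _).le,
    ← ENNReal.ofReal_mul (Real.exp_pos _).le, ← ENNReal.ofReal_mul (Real.exp_pos _).le,
    ← ENNReal.ofReal_add (mul_nonneg (Real.exp_pos _).le (hM0' _))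
      (mul_nonneg (Real.exp_pos _).le (hM0' _)),
    ← ENNReal.ofReal_add (mul_nonneg (Real.exp_pos _).le measureReal_nonneg)
      (add_nonneg (mul_nonneg (Real.exp_pos _).le (hM0' _))
        (mul_nonneg (Real.exp_pos _).le (hM0' _))),
    ENNReal.ofReal_le_ofReal_iff (add_nonneg (mul_nonneg (Real.exp_pos _).le measureReal_nonneg)
      (add_nonneg (mul_nonneg (Real.exp_pos _).le (hM0' _))
        (mul_nonneg (Real.exp_pos _).le (hM0' _))))] at hint
  have hq0 : 0 ≤ q := by positivity
  have hav : a * v = t := by rw [ha]; field_simp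
  have hθv : θ * v = κ := by rw [hθ]; field_simp
  have hκv : κ ^ 2 / (2 * v) = θ * κ / 2 := by rw [hθ]; field_simp
  set Y := Real.exp (q * (a ^ 2 * v / 2 - 3 * δ')) with hY
  have ht2 : Real.exp (-q * (θ * (t + κ))) * tiltMean α m γ ε (1 / 2) 0 (a + θ) n ^ N n ≤ Y := by
    refine (mul_le_mul_of_nonneg_left h2.2 (Real.exp_pos _).le).trans ?_
    rw [← Real.exp_add, hY]
    refine Real.exp_le_exp.2 ?_
    have e : (a + θ) ^ 2 * v / 2 = a ^ 2 * v / 2 + θ * t + θ * κ / 2 := by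
      rw [← hav, ← hθv]; ring
    rw [e]
    have := mul_le_mul_of_nonneg_left hδ'2 hq0
    rw [hκv] at this
    linarith
  have ht3 : Real.exp (q * (θ * (t - κ))) * tiltMean α m γ ε (1 / 2) 0 (a - θ) n ^ N n ≤ Y := by
    refine (mul_le_mul_of_nonneg_left h3.2 (Real.exp_pos _).le).trans ?_
    rw [← Real.exp_add, hY]
    refine Real.exp_le_exp.2 ?_
    have e : (a - θ) ^ 2 * v / 2 = a ^ 2 * v / 2 - θ * t + θ * κ / 2 := by
      rw [← hav, ← hθv]; ring
    rw [e]
    have := mul_le_mul_of_nonneg_left hδ'2 hq0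
    rw [hκv] at this
    linarith
  have hYpos : 0 < Y := Real.exp_pos _
  set Z := Real.exp (q * δ') with hZ
  have e1 : Real.exp (q * (a ^ 2 * v / 2 - δ')) = Y * Z * Z := by
    rw [hY, hZ, ← Real.exp_add, ← Real.exp_add]; congr 1; ring
  have e2 : Real.exp (q * (a ^ 2 * v / 2 - 2 * δ')) = Y * Z := by
    rw [hY, hZ, ← Real.exp_add]; congr 1; ring
  have h1' := h1.1
  rw [e1] at h1'
  have hYZ : 0 < Y * Z := mul_pos hYpos (Real.exp_pos _)
  -- The total is at least `Y Z²` and the outer part at most `2 Y`; since `Z ≥ 2`, at least `Y Z`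
  -- remains for the window.
  have hmain : Real.exp (q * (a ^ 2 * v / 2 - 2 * δ')) ≤
      Real.exp (q * (a * t + |a| * κ)) * P.real (bulkEvent X m γ t κ ε n (N n)) := by
    rw [e2]
    have h5 : Y * 2 ≤ Y * Z := mul_le_mul_of_nonneg_left h4 hYpos.le
    have h6 : Y * Z * 2 ≤ Y * Z * Z := mul_le_mul_of_nonneg_left h4 hYZ.le
    linarith
  rw [← div_le_iff₀' (Real.exp_pos _), ← Real.exp_sub] at hmain
  refine le_trans (Real.exp_le_exp.2 ?_) hmain
  have e3 : a * t - a ^ 2 * v / 2 = 1 / (2 * v) * t ^ 2 := by rw [ha]; field_simp; ring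
  have e4 : |a| * κ = |t| / v * κ := by rw [ha, abs_div, abs_of_pos hv0]
  rw [← e3, ← e4]
  have := mul_le_mul_of_nonneg_left hδ'1 hq0
  linarith

/-- Prescribe the variables `X N, …, X (n - 1)` in terms of the sum of the first `N`. -/
lemma IsIIDStretchedExp.measure_mul_le_of_prescribed {α : ℝ} (hX : IsIIDStretchedExp P α X)
    {N n : ℕ} (W : Set (Finset.range N → ℕ)) (ξ : ℕ → ℕ → ℕ) (Q : ℝ≥0∞)
    (hQ : ∀ ω, (fun i : Finset.range N => X i ω) ∈ W →
      Q ≤ ∏ i ∈ Finset.Ico N n, ENNReal.ofReal (weight α (ξ (partialSum X N ω) i))) :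
    P ((fun ω (i : Finset.range N) => X i ω) ⁻¹' W) * Q ≤
      P {ω | (fun i : Finset.range N => X i ω) ∈ W ∧
        ∀ i ∈ Finset.Ico N n, X i ω = ξ (partialSum X N ω) i} := by
  set Y : Ω → Finset.range N → ℕ := fun ω i => X i ω with hY
  set Y' : Ω → Finset.Ico N n → ℕ := fun ω i => X i ω with hY'
  have hYm : Measurable Y := hX.measurable_restrict _
  have hY'm : Measurable Y' := hX.measurable_restrict _
  have hind : IndepFun Y Y' P := by
    refine hX.indep.indepFun_finset _ _ ?_ hX.measurable
    rw [Finset.disjoint_left]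
    intro i hi hi'
    rw [Finset.mem_range] at hi
    rw [Finset.mem_Ico] at hi'
    omega
  -- The prescribed values depend on the first block only through its sum `u`. On each level set of
  -- the sum they are constants, so independence of the two blocks applies.
  let Wu : ℕ → Set (Finset.range N → ℕ) := fun u => W ∩ {z | ∑ i, z i = u}
  let D : ℕ → Set (Finset.Ico N n → ℕ) := fun u => {z | ∀ i, z i = ξ u i}
  have hWum : ∀ u, MeasurableSet (Wu u) := fun u => (Set.to_countable _).measurableSet
  have hDm : ∀ u, MeasurableSet (D u) := fun u => (Set.to_countable _).measurableSet
  have hdisj : Pairwise (Function.onFun Disjoint fun u => Y ⁻¹' Wu u) := by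
    intro u u' huu'
    refine Set.disjoint_left.2 fun ω h h' => huu' ?_
    exact h.2.symm.trans h'.2
  have hD : ∀ u, P (Y' ⁻¹' D u) = ∏ i ∈ Finset.Ico N n, ENNReal.ofReal (weight α (ξ u i)) := by
    intro u
    have h := hX.indep.measure_inter_preimage_eq_mul (Finset.Ico N n)
      (sets := fun i => {ξ u i}) fun i _ => measurableSet_singleton _
    have hl : ∀ i, P (X i ⁻¹' {ξ u i}) = ENNReal.ofReal (weight α (ξ u i)) :=
      fun i => hX.law i (ξ u i)
    simp only [hl] at h
    rw [← h]
    congr 1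
    ext ω
    simp only [D, hY', Set.mem_preimage, Set.mem_ofPred_eq, Set.mem_iInter, Set.mem_singleton_iff,
      Subtype.forall]
  have hsum : ∀ ω, partialSum X N ω = ∑ i, Y ω i := fun ω => partialSum_eq_sum_coe N ω
  have hunion : Y ⁻¹' W = ⋃ u, Y ⁻¹' Wu u := by
    ext ω
    simp [Wu]
  have hsub : (⋃ u, (Y ⁻¹' Wu u ∩ Y' ⁻¹' D u)) ⊆ {ω | Y ω ∈ W ∧
        ∀ i ∈ Finset.Ico N n, X i ω = ξ (partialSum X N ω) i} := by
    intro ω hω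
    obtain ⟨u, ⟨h1, h2⟩, h3⟩ := Set.mem_iUnion.1 hω
    have hu : partialSum X N ω = u := (hsum ω).trans h2
    refine ⟨h1, fun i hi => ?_⟩
    rw [hu]
    exact h3 ⟨i, hi⟩
  refine le_trans ?_ (measure_mono hsub)
  rw [hunion, measure_iUnion hdisj fun u => hYm (hWum u),
    measure_iUnion (fun u u' huu' => (hdisj huu').mono Set.inter_subset_left Set.inter_subset_left)
      fun u => (hYm (hWum u)).inter (hY'm (hDm u)), ← ENNReal.tsum_mul_right]
  refine ENNReal.tsum_le_tsum fun u => ?_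
  rw [hind.measure_inter_preimage_eq_mul _ _ (hWum u) (hDm u), hD]
  rcases (Y ⁻¹' Wu u).eq_empty_or_nonempty with he | ⟨ω, hω⟩
  · rw [he]; simp
  · refine mul_le_mul_right ?_ _
    have hu : partialSum X N ω = u := (hsum ω).trans hω.2
    rw [← hu]
    exact hQ ω hω.1

end Bulk

/-! ### Lower bound: prescribed jumps and exact correction of the sum -/

section LowerBound

variable {Ω : Type*} [MeasurableSpace Ω] {P : Measure Ω} {X : ℕ → Ω → ℕ}

lemma le_weight_of_le {α γ : ℝ} (hα : 0 < α) {z : ℝ} (hz : 0 ≤ z) {n d : ℕ}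
    (hd : (d : ℝ) ≤ z * (n : ℝ) ^ γ) :
    normConst α * Real.exp (-(n : ℝ) ^ (γ * α) * z ^ α) ≤ weight α d := by
  refine mul_le_mul_of_nonneg_left (Real.exp_le_exp.2 ?_) (normConst_pos hα).le
  have h := Real.rpow_le_rpow (Nat.cast_nonneg d) hd hα.le
  rw [Real.mul_rpow hz (by positivity), ← Real.rpow_mul (Nat.cast_nonneg n)] at h
  linarith

lemma tendsto_natCast_sub_div (k : ℕ) :
    Tendsto (fun n : ℕ => ((n - k : ℕ) : ℝ) / n) atTop (𝓝 1) := by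
  have h : Tendsto (fun n : ℕ => 1 - (k : ℝ) / n) atTop (𝓝 (1 - 0)) :=
    tendsto_const_nhds.sub (tendsto_const_div_atTop_nhds_zero_nat _)
  rw [sub_zero] at h
  refine h.congr' ?_
  filter_upwards [eventually_ge_atTop k, eventually_ge_atTop 1] with n hn hn1
  have : (n : ℝ) ≠ 0 := by positivity
  rw [Nat.cast_sub hn]
  field_simp

/-- Values of the last variables: `v` lists the jumps, the variable with index `N` corrects the
total to `K`. -/
def jumpVector (N K k : ℕ) (v : ℕ → ℕ) (u i : ℕ) : ℕ :=
  if i = N then K - u - ∑ j ∈ Finset.range (k + 1), v j else v (i - N - 1)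

lemma jumpVector_add_succ (N K k : ℕ) (v : ℕ → ℕ) (u j : ℕ) :
    jumpVector N K k v u (N + (j + 1)) = v j := by
  rw [jumpVector, if_neg (by omega)]
  congr 1
  omega

lemma jumpVector_self (N K k : ℕ) (v : ℕ → ℕ) (u : ℕ) :
    jumpVector N K k v u N = K - u - ∑ j ∈ Finset.range (k + 1), v j := if_pos rfl

/-- The correction needed after the bulk and the jumps is nonnegative and small. -/
lemma correction_bounds {m γ s r κ : ℝ} {n N K k u : ℕ} (hm : 0 ≤ m) (hn : n = N + (k + 2))
    (hK : m * n + r * (n : ℝ) ^ γ = K) (x : ℕ → ℝ≥0) (hr : |r - s| ≤ κ / 2)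
    (hbig : m * (k + 2) + (k + 1) ≤ κ / 2 * (n : ℝ) ^ γ)
    (hu : |(u : ℝ) - m * N -
      (s - ∑ j ∈ Finset.range (k + 1), (x j : ℝ) - 2 * κ) * (n : ℝ) ^ γ| ≤ κ * (n : ℝ) ^ γ) :
    u + ∑ j ∈ Finset.range (k + 1), ⌊(x j : ℝ) * (n : ℝ) ^ γ⌋₊ ≤ K ∧
    ((K - u - ∑ j ∈ Finset.range (k + 1), ⌊(x j : ℝ) * (n : ℝ) ^ γ⌋₊ : ℕ) : ℝ) ≤
      4 * κ * (n : ℝ) ^ γ := by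
  set p := (n : ℝ) ^ γ with hp
  have hp0 : 0 ≤ p := by positivity
  set U := ∑ j ∈ Finset.range (k + 1), (x j : ℝ) with hU
  set D := ∑ j ∈ Finset.range (k + 1), ⌊(x j : ℝ) * p⌋₊ with hD
  have hDle : (D : ℝ) ≤ U * p := by
    rw [hD, hU, Finset.sum_mul]
    push_cast
    exact Finset.sum_le_sum fun j _ => Nat.floor_le (by positivity)
  have hDge : U * p - (k + 1) ≤ D := by
    have h : ∑ j ∈ Finset.range (k + 1), ((x j : ℝ) * p - 1) ≤
        ∑ j ∈ Finset.range (k + 1), (⌊(x j : ℝ) * p⌋₊ : ℝ) :=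
      Finset.sum_le_sum fun j _ => (Nat.sub_one_lt_floor _).le
    rw [Finset.sum_sub_distrib, ← Finset.sum_mul] at h
    rw [hD]
    push_cast
    simpa using h
  have hnr : (n : ℝ) = N + (k + 2) := by rw [hn]; push_cast; ring
  rw [abs_le] at hu hr
  have h1 := mul_le_mul_of_nonneg_right hr.1 hp0
  have h2 := mul_le_mul_of_nonneg_right hr.2 hp0
  have hmk : 0 ≤ m * (k + 2) := by positivity
  have hKr : (K : ℝ) = m * N + m * (k + 2) + r * p := by rw [← hK, hnr]; ring
  have hκp : 0 ≤ κ / 2 * p := le_trans (by positivity) hbig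
  -- The bulk aims `2κ p` too low. The window loses at most `κ p` and `r - s` at most `κ p / 2`, so
  -- the correction is nonnegative. In the other direction rounding and the missing means add at
  -- most `κ p / 2`, for a total of `4κ p`.
  have hle : ((u + D : ℕ) : ℝ) ≤ K := by
    push_cast
    rw [hKr]
    linarith [hu.1, hu.2]
  have hle' : u + D ≤ K := by exact_mod_cast hle
  refine ⟨hle', ?_⟩
  rw [Nat.sub_sub, Nat.cast_sub hle']
  push_cast
  rw [hKr]
  linarith [hu.1, hu.2]

lemma sum_jumpVector {N K k u : ℕ} {v : ℕ → ℕ}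
    (h : u + ∑ j ∈ Finset.range (k + 1), v j ≤ K) :
    u + ∑ i ∈ Finset.range (k + 2), jumpVector N K k v u (N + i) = K := by
  rw [Finset.sum_range_succ']
  simp only [jumpVector_add_succ, add_zero, jumpVector_self]
  omega

/-- Lower bound for the joint probabilities. -/
lemma eventually_le_joint {α γ m v s J : ℝ} (hα₀ : 0 < α) (hα₁ : α < 1)
    (hγ : γ = 1 / (2 - α)) [IsProbabilityMeasure P] (hX : IsIIDStretchedExp P α X)
    (hm : ∑' k : ℕ, weight α k * (k : ℝ) = m)
    (hv : ∑' k : ℕ, weight α k * ((k : ℝ) - m) ^ 2 = v)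
    {sn : ℕ → ℝ} (hsn : ∀ n : ℕ, 1 ≤ n → ∃ k : ℕ, m * n + sn n * (n : ℝ) ^ γ = k)
    (hs : Tendsto sn atTop (𝓝 s)) {O : Set ℝ≥0} (hO : IsOpen O) {y : ℝ≥0} (hy : y ∈ O)
    (hJ : f α v s y < J) :
    ∀ᶠ n : ℕ in atTop, ENNReal.ofReal (Real.exp (-(n : ℝ) ^ (γ * α) * J)) ≤
      P {ω | (partialSum X n ω : ℝ) = m * n + sn n * (n : ℝ) ^ γ ∧
        (partialMax X n ω : ℝ≥0) / (n : ℝ≥0) ^ γ ∈ O} := by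
  have hv0 : 0 < v := hv ▸ tsum_weight_mul_sq_sub_pos hα₀ m
  have hm0 : 0 ≤ m := hm ▸ tsum_nonneg fun k => mul_nonneg (weight_pos hα₀ k).le (by positivity)
  obtain ⟨x, k, hx, hx0, hc⟩ := exists_finCost_lt hv0 hJ
  obtain ⟨ρ, hρ, hball⟩ := Metric.isOpen_iff.1 hO y hy
  unfold finCost at hc
  set S₁ := ∑ j ∈ Finset.range (k + 1), (x j : ℝ) ^ α with hS₁
  set U := ∑ j ∈ Finset.range (k + 1), (x j : ℝ) with hU
  -- Cost of the construction with slack `κ`: the jumps, one correction of size at most `4κ n^γ`,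
  -- and the bulk shift with its window. It is continuous in `κ`, and at `κ = 0` it is the cost of
  -- the family `x`.
  let φ : ℝ → ℝ := fun κ => S₁ + (4 * κ) ^ α +
    (1 / (2 * v) * (s - U - 2 * κ) ^ 2 + |s - U - 2 * κ| / v * κ)
  have hφ0 : φ 0 < J := by
    simp only [φ, mul_zero, Real.zero_rpow hα₀.ne', add_zero, sub_zero]
    exact hc
  have hφc : Continuous φ := by
    have : Continuous fun κ : ℝ => (4 * κ) ^ α :=
      (continuous_const_mul 4).rpow_const fun _ => Or.inr hα₀.le
    fun_prop
  obtain ⟨κ, hκ, hκJ, hκρ⟩ : ∃ κ : ℝ, 0 < κ ∧ φ κ < J ∧ κ < ρ / 8 := by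
    have h0 : ∀ᶠ κ in 𝓝[>] (0 : ℝ), 0 < κ := self_mem_nhdsWithin
    have h1 : ∀ᶠ κ in 𝓝[>] (0 : ℝ), φ κ < J :=
      nhdsWithin_le_nhds ((hφc.tendsto 0).eventually_lt_const hφ0)
    have h2 : ∀ᶠ κ in 𝓝[>] (0 : ℝ), κ < ρ / 8 :=
      nhdsWithin_le_nhds (eventually_lt_nhds (by positivity))
    exact (h0.and (h1.and h2)).exists
  set δ := (J - φ κ) / 2 with hδ
  have hδ0 : 0 < δ := by linarith
  set c := normConst α with hcdef
  have hc0 : 0 < c := normConst_pos hα₀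
  set t := s - U - 2 * κ with ht
  have hp := tendsto_natCast_rpow_gamma hα₁ hγ
  -- The `k + 2` variables left out of the bulk are `k + 1` jumps and one correction. The cap `ρ /
  -- 2` on the bulk, and `4κ < ρ / 2` for the correction, keep the maximum within the ball around
  -- `y`.
  have hev1 := eventually_le_bulkEvent (t := t) (κ := κ) (ε₀ := ρ / 2) (δ := δ) hα₀ hα₁ hγ hX hm hv
    (tendsto_natCast_sub_div (k + 2)) hκ (by positivity) hδ0
  -- The normalizing constants of the prescribed variables form a fixed factor, negligible at
  -- exponential scale.
  have hev2 : ∀ᶠ n : ℕ in atTop, (c ^ (k + 2))⁻¹ ≤ Real.exp ((n : ℝ) ^ (γ * α) * δ) :=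
    (Real.tendsto_exp_atTop.comp ((tendsto_natCast_rpow_gamma_mul_alpha hα₀ hα₁ hγ).atTop_mul_const
      hδ0)).eventually_ge_atTop _
  have hev3 : ∀ᶠ n : ℕ in atTop, |sn n - s| ≤ κ / 2 := by
    have h : Tendsto (fun n => |sn n - s|) atTop (𝓝 0) := by
      simpa using (hs.sub_const s).abs
    exact h.eventually_le_const (by linarith)
  have hev4 : ∀ᶠ n : ℕ in atTop, m * (k + 2) + (k + 1) ≤ κ / 2 * (n : ℝ) ^ γ :=
    (hp.const_mul_atTop (by linarith : 0 < κ / 2)).eventually_ge_atTop _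
  have hev5 : ∀ᶠ n : ℕ in atTop, 1 < ρ * (n : ℝ) ^ γ :=
    (hp.const_mul_atTop hρ).eventually_gt_atTop _
  filter_upwards [hev1, hev2, hev3, hev4, hev5, eventually_ge_atTop (k + 2)] with n h1 h2 h3 h4 h5 hn
  obtain ⟨K, hK⟩ := hsn n (by omega)
  set N := n - (k + 2) with hN
  have hnN : n = N + (k + 2) := by omega
  have hn' : (0 : ℝ) < n := by exact_mod_cast (by omega : 0 < n)
  set q := (n : ℝ) ^ (γ * α) with hq
  have hp0 : 0 < (n : ℝ) ^ γ := by positivity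
  let w : ℕ → ℕ := fun j => ⌊(x j : ℝ) * (n : ℝ) ^ γ⌋₊
  have hwle : ∀ j, (w j : ℝ) ≤ x j * (n : ℝ) ^ γ := fun j => Nat.floor_le (by positivity)
  have hcorr : ∀ ω ∈ bulkEvent X m γ t κ (ρ / 2) n N,
      partialSum X N ω + ∑ j ∈ Finset.range (k + 1), w j ≤ K ∧
      ((K - partialSum X N ω - ∑ j ∈ Finset.range (k + 1), w j : ℕ) : ℝ) ≤
        4 * κ * (n : ℝ) ^ γ :=
    fun ω hω => correction_bounds hm0 hnN hK x h3 h4 hω.1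
  have hfib := hX.measure_mul_le_of_prescribed (n := n) (bulkSet m γ t κ (ρ / 2) n N)
    (jumpVector N K k w) (ENNReal.ofReal (c ^ (k + 2) * Real.exp (-q * ((4 * κ) ^ α + S₁))))
    (by
      intro ω hω
      have hω' : ω ∈ bulkEvent X m γ t κ (ρ / 2) n N := by
        rw [bulkEvent_eq_preimage]; exact hω
      rw [← ENNReal.ofReal_prod_of_nonneg fun i _ => (weight_pos hα₀ _).le]
      refine ENNReal.ofReal_le_ofReal ?_
      rw [Finset.prod_Ico_eq_prod_range, show n - N = k + 1 + 1 by omega, Finset.prod_range_succ']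
      simp only [jumpVector_add_succ, add_zero, jumpVector_self]
      have e : c ^ (k + 2) * Real.exp (-q * ((4 * κ) ^ α + S₁)) =
          (∏ j ∈ Finset.range (k + 1), (c * Real.exp (-q * (x j : ℝ) ^ α))) *
            (c * Real.exp (-q * (4 * κ) ^ α)) := by
        rw [Finset.prod_mul_distrib, Finset.prod_const, Finset.card_range, ← Real.exp_sum,
          ← Finset.mul_sum, mul_add, Real.exp_add]
        ring
      rw [e]
      refine mul_le_mul (Finset.prod_le_prod (fun j _ => by positivity) fun j _ =>
          le_weight_of_le hα₀ (NNReal.coe_nonneg _) (hwle j))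
        (le_weight_of_le hα₀ (by positivity) (hcorr ω hω').2) (by positivity)
        (Finset.prod_nonneg fun j _ => (weight_pos hα₀ _).le))
  rw [← bulkEvent_eq_preimage] at hfib
  refine le_trans (le_trans ?_ hfib) (measure_mono ?_)
  · rw [← ofReal_measureReal, ← ENNReal.ofReal_mul measureReal_nonneg]
    refine ENNReal.ofReal_le_ofReal ?_
    have h6 : Real.exp (-q * δ) ≤ c ^ (k + 2) := by
      rw [neg_mul, Real.exp_neg]
      exact inv_le_of_inv_le₀ (by positivity) h2
    calc Real.exp (-q * J) = Real.exp (-q * (1 / (2 * v) * t ^ 2 + |t| / v * κ + δ)) *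
          (Real.exp (-q * δ) * Real.exp (-q * ((4 * κ) ^ α + S₁))) := by
          rw [← Real.exp_add, ← Real.exp_add]
          congr 1
          have : J = φ κ + 2 * δ := by rw [hδ]; ring
          rw [this]
          simp only [φ]
          rw [← ht]
          ring
      _ ≤ _ := by gcongr
  · rintro ω ⟨hω, hval⟩
    have hω' : ω ∈ bulkEvent X m γ t κ (ρ / 2) n N := by
      rw [bulkEvent_eq_preimage]; exact hω
    obtain ⟨hc1, hc2⟩ := hcorr ω hω'
    have hval' : ∀ i < k + 2, X (N + i) ω = jumpVector N K k w (partialSum X N ω) (N + i) :=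
      fun i hi => hval _ (Finset.mem_Ico.2 ⟨by omega, by omega⟩)
    have hsum : partialSum X n ω = K := by
      have e : partialSum X n ω = partialSum X N ω + ∑ i ∈ Finset.range (k + 2), X (N + i) ω := by
        conv_lhs => rw [partialSum, hnN, Finset.sum_range_add]
        rfl
      rw [e, Finset.sum_congr rfl fun i hi => hval' i (Finset.mem_range.1 hi)]
      exact sum_jumpVector hc1
    refine ⟨by rw [hsum, hK], hball ?_⟩
    have hle : ∀ i < n, (X i ω : ℝ) ≤ (y + ρ / 2) * (n : ℝ) ^ γ := by
      intro i hi
      have hy0 : 0 ≤ (y : ℝ) * (n : ℝ) ^ γ := by positivity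
      have hρ0 : 0 ≤ ρ / 2 * (n : ℝ) ^ γ := by positivity
      rw [add_mul]
      rcases lt_or_ge i N with hiN | hiN
      · linarith [hω'.2 i (Finset.mem_range.2 hiN)]
      · obtain ⟨j, rfl⟩ := Nat.exists_eq_add_of_le hiN
        rw [hval' j (by omega)]
        cases j with
        | zero =>
          rw [add_zero, jumpVector_self]
          have : 4 * κ * (n : ℝ) ^ γ ≤ ρ / 2 * (n : ℝ) ^ γ := by gcongr; linarith
          linarith
        | succ j =>
          rw [jumpVector_add_succ]
          have hxy : (x j : ℝ) ≤ y := by exact_mod_cast hx j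
          have : (x j : ℝ) * (n : ℝ) ^ γ ≤ y * (n : ℝ) ^ γ := by gcongr
          linarith [hwle j]
    obtain ⟨i₀, hi₀, hi₀'⟩ := Finset.exists_mem_eq_sup (Finset.range n)
      (Finset.nonempty_range_iff.2 (by omega)) fun i => X i ω
    have hMle : (partialMax X n ω : ℝ) ≤ (y + ρ / 2) * (n : ℝ) ^ γ := by
      rw [partialMax, hi₀']
      exact hle i₀ (Finset.mem_range.1 hi₀)
    -- Index `N` is the correction, so the largest prescribed jump, for `x 0 = y`, sits at index `N
    -- + 1`.
    have hMge : (y : ℝ) * (n : ℝ) ^ γ - 1 < partialMax X n ω := by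
      have e1 : X (N + 1) ω = w 0 := by rw [hval' 1 (by omega)]; exact jumpVector_add_succ _ _ _ _ _ 0
      have e2 : w 0 ≤ partialMax X n ω := by
        rw [← e1]
        exact Finset.le_sup (f := fun i => X i ω) (Finset.mem_range.2 (by omega))
      have e3 : (x 0 : ℝ) * (n : ℝ) ^ γ - 1 < w 0 := Nat.sub_one_lt_floor _
      rw [hx0] at e3
      exact e3.trans_le (by exact_mod_cast e2)
    rw [Metric.mem_ball, NNReal.dist_eq, abs_lt]
    push_cast
    constructor
    · rw [lt_sub_iff_add_lt, lt_div_iff₀ hp0]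
      linarith
    · rw [sub_lt_iff_lt_add, div_lt_iff₀ hp0]
      exact hMle.trans_lt (mul_lt_mul_of_pos_right (by linarith) hp0)

end LowerBound

/-! ### From joint probabilities to the conditional law -/

section Conditioning

variable {Ω : Type*} [MeasurableSpace Ω] {P : Measure Ω} {X : ℕ → Ω → ℕ}

/-- The denominator is kept in the form of a joint event with `Set.univ`, so that the same two
estimates serve both parts of the ratio. -/
lemma IsIIDStretchedExp.condMaxLaw_apply {α : ℝ} (hX : IsIIDStretchedExp P α X) (γ : ℝ) (n : ℕ)
    (a : ℝ) {A : Set ℝ≥0} (hA : MeasurableSet A) :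
    condMaxLaw P X γ n a A = (P {ω | (partialSum X n ω : ℝ) = a ∧
        (partialMax X n ω : ℝ≥0) / (n : ℝ≥0) ^ γ ∈ Set.univ})⁻¹ *
      P {ω | (partialSum X n ω : ℝ) = a ∧ (partialMax X n ω : ℝ≥0) / (n : ℝ≥0) ^ γ ∈ A} := by
  have h1 : Measurable fun ω => (partialMax X n ω : ℝ≥0) / (n : ℝ≥0) ^ γ :=
    (measurable_of_countable fun k : ℕ => (k : ℝ≥0) / (n : ℝ≥0) ^ γ).comp
      (hX.measurable_partialMax n)
  have h2 : MeasurableSet {ω | (partialSum X n ω : ℝ) = a} :=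
    hX.measurable_partialSum n (Set.to_countable {k : ℕ | (k : ℝ) = a}).measurableSet
  rw [condMaxLaw, Measure.map_apply h1 hA, cond_apply h2]
  simp only [Set.mem_univ, and_true]
  rfl

lemma log_div_le_of_le_exp {x : ℝ≥0∞} {q c : ℝ} (hq : 0 < q)
    (h : x ≤ ENNReal.ofReal (Real.exp (q * c))) : ENNReal.log x / (q : EReal) ≤ (c : EReal) := by
  have h1 := ENNReal.log_le_log h
  rw [ENNReal.log_ofReal_of_pos (Real.exp_pos _), Real.log_exp] at h1
  refine (EReal.div_le_div_right_of_nonneg (by exact_mod_cast hq.le) h1).trans (le_of_eq ?_)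
  rw [← EReal.coe_div, mul_div_cancel_left₀ _ hq.ne']

lemma le_log_div_of_exp_le {x : ℝ≥0∞} {q c : ℝ} (hq : 0 < q)
    (h : ENNReal.ofReal (Real.exp (q * c)) ≤ x) : (c : EReal) ≤ ENNReal.log x / (q : EReal) := by
  have h1 := ENNReal.log_le_log h
  rw [ENNReal.log_ofReal_of_pos (Real.exp_pos _), Real.log_exp] at h1
  refine le_trans (le_of_eq ?_) (EReal.div_le_div_right_of_nonneg (by exact_mod_cast hq.le) h1)
  rw [← EReal.coe_div, mul_div_cancel_left₀ _ hq.ne']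

/-- The numerator is estimated by `A` or `O`, the denominator in the opposite direction by the whole
space, where the infimum of `f` is `I₀`. The exponents subtract. -/
lemma satisfiesLDP_condMaxLaw {α γ m v s : ℝ} (hα₀ : 0 < α) (hα₁ : α < 1)
    (hγ : γ = 1 / (2 - α)) [IsProbabilityMeasure P] (hX : IsIIDStretchedExp P α X)
    (hm : ∑' k : ℕ, weight α k * (k : ℝ) = m)
    (hv : ∑' k : ℕ, weight α k * ((k : ℝ) - m) ^ 2 = v)
    {sn : ℕ → ℝ} (hsn : ∀ n : ℕ, 1 ≤ n → ∃ k : ℕ, m * n + sn n * (n : ℝ) ^ γ = k)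
    (hs : Tendsto sn atTop (𝓝 s)) :
    SatisfiesLDP (fun n => condMaxLaw P X γ n (m * n + sn n * (n : ℝ) ^ γ))
      (fun n => (n : ℝ) ^ (γ * α))
      (fun y : ℝ≥0 => f α v s y - ⨅ z : ℝ≥0, f α v s z) := by
  have hv0 : 0 < v := hv ▸ tsum_weight_mul_sq_sub_pos hα₀ m
  obtain ⟨I₀, hI₀⟩ := exists_iInf_f_eq_coe hα₀ hv0 s
  rw [hI₀]
  have hqpos : ∀ᶠ n : ℕ in atTop, (0 : ℝ) < (n : ℝ) ^ (γ * α) :=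
    (tendsto_natCast_rpow_gamma_mul_alpha hα₀ hα₁ hγ).eventually_gt_atTop 0
  constructor
  · intro A hA
    by_contra hcon
    obtain ⟨c, hc1, hc2⟩ := EReal.lt_iff_exists_real_btwn.1 (not_le.1 hcon)
    obtain ⟨b, hb1, hb2⟩ := EReal.lt_iff_exists_real_btwn.1 (EReal.neg_lt_comm.1 hc1)
    have hcb : -c < b := by exact_mod_cast hb1
    have hAf : ∀ y ∈ A, ((b + I₀ : ℝ) : EReal) ≤ f α v s y := by
      intro y hy
      have h := hb2.le.trans (iInf₂_le y hy)
      rwa [EReal.le_sub_iff_add_le (by simp) (by simp), ← EReal.coe_add] at h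
    -- One `δ` is lost in the numerator and one in the denominator, so the exponent becomes `-b + 2δ
    -- = c`.
    set δ := (b + c) / 2 with hδ
    have hδ0 : 0 < δ := by linarith
    obtain ⟨y, hy⟩ : ∃ y, f α v s y < ((I₀ + δ : ℝ) : EReal) := by
      rw [← iInf_lt_iff, hI₀, EReal.coe_lt_coe_iff]; linarith
    have hup := eventually_joint_le hα₀ hα₁ hγ hX hm hv hs hA hAf
      (by linarith : b + I₀ - δ < b + I₀)
    have hlow := eventually_le_joint hα₀ hα₁ hγ hX hm hv hsn hs isOpen_univ (Set.mem_univ y) hy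
    refine absurd (limsup_le_of_le (h := ?_)) (not_le.2 hc2)
    filter_upwards [hup, hlow, hqpos] with n h1 h2 hq
    refine log_div_le_of_le_exp hq ?_
    rw [hX.condMaxLaw_apply γ n _ hA.measurableSet]
    refine (mul_le_mul' (ENNReal.inv_le_inv.2 h2) h1).trans (le_of_eq ?_)
    rw [← ENNReal.ofReal_inv_of_pos (Real.exp_pos _), ← Real.exp_neg,
      ← ENNReal.ofReal_mul (Real.exp_pos _).le, ← Real.exp_add]
    congr 2
    rw [hδ]
    ring
  · intro O hO
    by_contra hcon
    obtain ⟨c, hc1, hc2⟩ := EReal.lt_iff_exists_real_btwn.1 (not_le.1 hcon)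
    have hlt := EReal.lt_neg_comm.1 hc2
    simp only [iInf_lt_iff] at hlt
    obtain ⟨y, hy, hyc⟩ := hlt
    rw [EReal.sub_lt_iff (by simp) (by simp)] at hyc
    obtain ⟨b, hb1, hb2⟩ := EReal.lt_iff_exists_real_btwn.1 hyc
    have hbc : b < -c + I₀ := by exact_mod_cast hb2
    -- The gap is spent entirely on the denominator: `(I₀ - δ) - b = c`.
    set δ := I₀ - c - b with hδ
    have hδ0 : 0 < δ := by linarith
    have hup := eventually_joint_le hα₀ hα₁ hγ hX hm hv hs isClosed_univ (J := I₀)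
      (fun y _ => hI₀ ▸ iInf_le _ y) (by linarith : I₀ - δ < I₀)
    have hlow := eventually_le_joint hα₀ hα₁ hγ hX hm hv hsn hs hO hy hb1
    refine absurd (le_liminf_of_le (h := ?_)) (not_le.2 hc1)
    filter_upwards [hup, hlow, hqpos] with n h1 h2 hq
    refine le_log_div_of_exp_le hq ?_
    rw [hX.condMaxLaw_apply γ n _ hO.measurableSet]
    refine le_trans (le_of_eq ?_) (mul_le_mul' (ENNReal.inv_le_inv.2 h1) h2)
    rw [← ENNReal.ofReal_inv_of_pos (Real.exp_pos _), ← Real.exp_neg,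
      ← ENNReal.ofReal_mul (Real.exp_pos _).le, ← Real.exp_add]
    congr 2
    rw [hδ]
    ring

end Conditioning

end StretchedExp

end

theorem theorem2p1 {Ω : Type*} [MeasurableSpace Ω] (P : Measure Ω) [IsProbabilityMeasure P]
    (α : ℝ) (hα₀ : 0 < α) (hα₁ : α < 1)
    (X : ℕ → Ω → ℕ) (hX : StretchedExp.IsIIDStretchedExp P α X)
    (μ σ2 γ : ℝ)
    (hμ : μ = ∫ ω, (X 0 ω : ℝ) ∂P)
    (hσ2 : σ2 = ProbabilityTheory.variance (fun ω => (X 0 ω : ℝ)) P)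
    (hγ : γ = 1 / (2 - α))
    (s : ℝ) (sn : ℕ → ℝ)
    (hsn : ∀ n : ℕ, 1 ≤ n → ∃ k : ℕ, μ * n + sn n * (n : ℝ) ^ γ = k)
    (hs : Tendsto sn atTop (𝓝 s)) :
    -- `f` is finite and satisfies the recursion, for every real parameter `r`
    (∀ (r : ℝ) (y : ℝ≥0), 0 ≤ StretchedExp.f α σ2 r y ∧ StretchedExp.f α σ2 r y < ⊤) ∧
    (∀ (r : ℝ) (y : ℝ≥0), StretchedExp.f α σ2 r y =
      (((y : ℝ) ^ α : ℝ) : EReal) + ⨅ z ∈ Set.Icc 0 y, StretchedExp.f α σ2 (r - y) z) ∧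
    StretchedExp.IsGoodRateFunction
      (fun y : ℝ≥0 => StretchedExp.f α σ2 s y - ⨅ z : ℝ≥0, StretchedExp.f α σ2 s z) ∧
    StretchedExp.SatisfiesLDP
      (fun n => StretchedExp.condMaxLaw P X γ n (μ * n + sn n * (n : ℝ) ^ γ))
      (fun n => (n : ℝ) ^ (γ * α))
      (fun y : ℝ≥0 => StretchedExp.f α σ2 s y - ⨅ z : ℝ≥0, StretchedExp.f α σ2 s z) := by
  have hm : ∑' k : ℕ, StretchedExp.weight α k * (k : ℝ) = μ := by
    rw [hμ, hX.integral_eq hα₀ 0]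
  have hv : ∑' k : ℕ, StretchedExp.weight α k * ((k : ℝ) - μ) ^ 2 = σ2 := by
    rw [hσ2, hX.variance_eq hα₀ 0, hμ]
  have hσ : 0 < σ2 := hv ▸ StretchedExp.tsum_weight_mul_sq_sub_pos hα₀ μ
  exact ⟨fun r y => ⟨StretchedExp.f_nonneg hσ r y, StretchedExp.f_lt_top hα₀ σ2 r y⟩,
    StretchedExp.f_eq_rpow_add_iInf, StretchedExp.isGoodRateFunction_f_sub hα₀ hα₁ hσ s,
    StretchedExp.satisfiesLDP_condMaxLaw hα₀ hα₁ hγ hX hm hv hsn hs⟩
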